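/- Let $d\ge 1$ and $n\ge d$ be integers, and let $X_1,X_2,\dots$ be independent identically distributed random vectors in $\mathbb R^d$ such that (H) $\mathbb P(X_1\in h)=0$ for every affine hyperplane $h\subset\mathbb R^d$. No moment assumption is made. Let $S_0=0$, $S_k=X_1+\dots+X_k$ be the corresponding random walk, let $C_n=\operatorname{conv}(S_0,S_1,\dots,S_n)$ be the convex hull of its first $n$ steps including the origin, let $\partial C_n$ be its boundary in $\mathbb R^d$, and let $S^{(1)},\dots,S^{(d-1)}$ be independent copies of the random walk $S=(S_k)_{k\ge 0}$. Then the surface area $\operatorname{Vol}_{d-1}(\partial C_n)$ (the $(d-1)$-dimensional Hausdorff measure, normalized to agree with Lebesgue measure on $\mathbb R^{d-1}$) coincides almost surely with a random variable, and, as an identity in $[0,\infty]$, $$ \mathbb E\operatorname{Vol}_{d-1}(\partial C_n)=\frac{2}{(d-1)!}\sum_{\substack{j_1+\dots+j_{d-1}\le n\\ j_1,\dots,j_{d-1}\ge 1}}\frac{\mathbb E\,\sqrt{\det\Bigl(\bigl\langle S^{(m)}_{j_m},S^{(\ell)}_{j_\ell}\bigr\rangle\Bigr)_{m,\ell=1}^{d-1}}}{j_1\cdots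 j_{d-1}} . $$ (For $d=1$ the sum consists of the single empty tuple and both sides equal $2$.) In particular, for $d=2$ this is the Spitzer–Widom formula for the expected perimeter, $$ \mathbb E\operatorname{Vol}_1(\partial C_n)=2\sum_{j=1}^n\frac{\mathbb E\|S_j\|}{j}. $$ -/

import Mathlib

open MeasureTheory ProbabilityTheory
open scoped ENNReal Nat

noncomputable section

/-- The random walk `S_k = X_1 + ⋯ + X_k`, `S_0 = 0`, with increments `X_1, X_2, …`;
the increment `X_{i+1}` is written `X i`. -/
def walk {Ω : Type*} {d : ℕ} (X : ℕ → Ω → EuclideanSpace ℝ (Fin d)) (k : ℕ) (ω : Ω) :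
    EuclideanSpace ℝ (Fin d) :=
  ∑ i ∈ Finset.range k, X i ω

/-- The convex hull `C_n` of the points `S_0 = 0, S_1, …, S_n`. -/
def walkHull {Ω : Type*} {d : ℕ} (X : ℕ → Ω → EuclideanSpace ℝ (Fin d)) (n : ℕ) (ω : Ω) :
    Set (EuclideanSpace ℝ (Fin d)) :=
  convexHull ℝ ((fun k => walk X k ω) '' Set.Iic n)

/-- The random vector `Y` hits every affine hyperplane `{x | ⟨u, x⟩ = c}`, `u ≠ 0`,
with probability zero. -/
def ChargesNoHyperplane {Ω : Type*} [MeasurableSpace Ω] {d : ℕ}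
    (Y : Ω → EuclideanSpace ℝ (Fin d)) (P : Measure Ω) : Prop :=
  ∀ (u : EuclideanSpace ℝ (Fin d)) (c : ℝ), u ≠ 0 → P {ω | inner ℝ u (Y ω) = c} = 0

/-- The tuples `(j_1, …, j_k)` of integers `j_m ≥ 1` with `j_1 + ⋯ + j_k ≤ n`. -/
def stepTuples (k n : ℕ) : Finset (Fin k → ℕ) :=
  (Fintype.piFinset fun _ => Finset.Icc 1 n).filter fun j => ∑ m, j m ≤ n

theorem mem_stepTuples {k n : ℕ} {j : Fin k → ℕ} :
    j ∈ stepTuples k n ↔ (∀ m, 1 ≤ j m) ∧ ∑ m, j m ≤ n := by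
  simp only [stepTuples, Finset.mem_filter, Fintype.mem_piFinset, Finset.mem_Icc]
  refine ⟨fun h => ⟨fun m => (h.1 m).1, h.2⟩, fun h => ⟨fun m => ⟨h.1 m, ?_⟩, h.2⟩⟩
  exact (Finset.single_le_sum (fun i _ => Nat.zero_le (j i)) (Finset.mem_univ m)).trans h.2

end

/-! Write `d = k + 1`. Almost surely the points `S_0, …, S_n` are in general position: successive
differences along an increasing index tuple are sums over disjoint groups of steps, hence
independent, and no such sum charges a hyperplane (`ae_inGeneralPosition`). The boundary of the hull
is then, up to a null set, an essentially disjoint union of simplices on `k + 1` vertices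
(`InGeneralPosition.measure_frontier`), each of volume `1 / k!` times the square root of the Gram
determinant of its edges.

A candidate facet is given by its first index `i` and the gaps `j` between consecutive indices. It
is a facet exactly when all other points lie strictly on one side of its hyperplane; the two sides
contribute equally, whence the factor 2.

Fix `j` and a side, and let `J` be the sum of the gaps. Put the marked blocks in the first `J`
steps. Rotate each block cyclically by some `c m < j m` and insert the `J` steps after the first `i`
of the remaining ones. The edges do not change, so neither do the volume and the normal direction,
and the law of the walk is invariant. Inside block `m` the level along the normal is a bridge, which
exactly one rotation makes positive. Outside the blocks the level is that of the walk with the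
blocks removed, and `i` must be its strict minimum. So exactly one choice of `(c, i)` produces a
facet on the given side (`sum_liesAbove_rearrange`). Summing over all choices, the product of the `j
m` times the sum over `i` of the expected facet volumes is the expected Gram volume
(`lintegral_sum_facetVolume`). The edges are independent walk positions at times `j m`, which brings
in the independent copies. -/

/-! ### Volume of a simplex. -/

/-- The simplex of antitone tuples with entries in `[0, r]`. -/
def antitoneSimplex (k : ℕ) (r : ℝ) : Set (Fin k → ℝ) :=
  {t | Antitone t ∧ ∀ i, t i ∈ Set.Icc 0 r}

theorem isClosed_antitoneSimplex (k : ℕ) (r : ℝ) : IsClosed (antitoneSimplex k r) := by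
  have h : antitoneSimplex k r = (⋂ (a : Fin k) (b : Fin k) (_ : a ≤ b), {t | t b ≤ t a}) ∩
      ⋂ i, {t | t i ∈ Set.Icc 0 r} := by
    ext t
    simp [antitoneSimplex, Antitone]
  rw [h]
  refine IsClosed.inter ?_ ?_
  · exact isClosed_iInter fun a => isClosed_iInter fun b => isClosed_iInter fun _ =>
      isClosed_le (continuous_apply b) (continuous_apply a)
  · exact isClosed_iInter fun i => isClosed_Icc.preimage (continuous_apply i)

/-- The first coordinate is the largest, so fixing it leaves a smaller simplex of the same kind;
this is the recursion behind the volume. -/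
theorem cons_mem_antitoneSimplex {k : ℕ} {r s : ℝ} {t : Fin k → ℝ} :
    (Fin.cons s t : Fin (k + 1) → ℝ) ∈ antitoneSimplex (k + 1) r ↔
      s ∈ Set.Icc 0 r ∧ t ∈ antitoneSimplex k s := by
  simp only [antitoneSimplex, Set.mem_ofPred_eq, Fin.forall_fin_succ, Fin.cons_zero, Fin.cons_succ]
  constructor
  · rintro ⟨h, hs, ht⟩
    refine ⟨hs, fun a b hab => ?_, fun i => ⟨(ht i).1, ?_⟩⟩
    · simpa using h (Fin.succ_le_succ_iff.2 hab)
    · simpa using h (Fin.zero_le i.succ)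
  · rintro ⟨hs, h, ht⟩
    refine ⟨fun a b => ?_, hs, fun i => ⟨(ht i).1, (ht i).2.trans hs.2⟩⟩
    refine Fin.cases ?_ (fun a => ?_) a <;> refine Fin.cases ?_ (fun b => ?_) b
    · simp
    · simpa using (ht b).2
    · simp
    · intro hab
      simpa using h (Fin.succ_le_succ_iff.1 hab)

theorem volume_antitoneSimplex (k : ℕ) {r : ℝ} (hr : 0 ≤ r) :
    volume (antitoneSimplex k r) = ENNReal.ofReal (r ^ k / k !) := by
  induction k generalizing r with
  | zero =>
    have h : antitoneSimplex 0 r = Set.univ := by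
      ext t
      simp [antitoneSimplex, Antitone]
    rw [h, volume_pi, Measure.pi_of_empty]
    simp
  | succ k ih =>
    have hm := (volume_preserving_piFinSuccAbove (fun _ : Fin (k + 1) => ℝ) 0).symm
    rw [← hm.measure_preimage (isClosed_antitoneSimplex _ _).measurableSet.nullMeasurableSet,
      Measure.volume_eq_prod, Measure.prod_apply
        (hm.measurable (isClosed_antitoneSimplex _ _).measurableSet)]
    have h1 : ∀ s : ℝ, volume (Prod.mk s ⁻¹'
        ((MeasurableEquiv.piFinSuccAbove (fun _ : Fin (k + 1) => ℝ) 0).symm ⁻¹'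
          antitoneSimplex (k + 1) r)) =
        (Set.Icc 0 r).indicator (fun s => ENNReal.ofReal (s ^ k / k !)) s := by
      intro s
      have h2 : (Prod.mk s ⁻¹' ((MeasurableEquiv.piFinSuccAbove (fun _ : Fin (k + 1) => ℝ) 0).symm
          ⁻¹' antitoneSimplex (k + 1) r)) = {t | s ∈ Set.Icc 0 r ∧ t ∈ antitoneSimplex k s} := by
        ext t
        simp only [Set.mem_preimage, Set.mem_ofPred_eq, ← cons_mem_antitoneSimplex]
        simp only [MeasurableEquiv.piFinSuccAbove, MeasurableEquiv.symm_mk, MeasurableEquiv.coe_mk,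
          Fin.insertNthEquiv_zero]
        rfl
      rw [h2]
      by_cases hs : s ∈ Set.Icc 0 r
      · simp only [hs, true_and, Set.ofPred_mem_eq, Set.indicator_of_mem]
        exact ih hs.1
      · simp [hs]
    simp_rw [h1]
    rw [lintegral_indicator measurableSet_Icc,
      ← ofReal_integral_eq_lintegral_ofReal]
    · congr 1
      rw [integral_Icc_eq_integral_Ioc, ← intervalIntegral.integral_of_le hr,
        intervalIntegral.integral_div, integral_pow, Nat.factorial_succ]
      push_cast
      field_simp
      simp
    · exact (Continuous.integrableOn_Icc (by fun_prop))
    · refine (ae_restrict_iff' measurableSet_Icc).2 (Filter.Eventually.of_forall fun s hs => ?_)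
      have := hs.1
      simp only [Pi.zero_apply]
      positivity

theorem convex_antitoneSimplex (k : ℕ) (r : ℝ) : Convex ℝ (antitoneSimplex k r) := by
  intro x hx y hy a b ha hb hab
  refine ⟨fun i j hij => ?_, fun i => ⟨?_, ?_⟩⟩
  · have h1 := mul_le_mul_of_nonneg_left (hx.1 hij) ha
    have h2 := mul_le_mul_of_nonneg_left (hy.1 hij) hb
    simpa using add_le_add h1 h2
  · have h1 := mul_nonneg ha (hx.2 i).1
    have h2 := mul_nonneg hb (hy.2 i).1
    simpa using add_nonneg h1 h2
  · have h1 := mul_le_mul_of_nonneg_left (hx.2 i).2 ha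
    have h2 := mul_le_mul_of_nonneg_left (hy.2 i).2 hb
    calc (a • x + b • y) i ≤ a * r + b * r := by simpa using add_le_add h1 h2
      _ = r := by rw [← add_mul, hab, one_mul]

/-- The antitone simplex is spanned by its staircase vertices. -/
theorem convexHull_staircase (k : ℕ) :
    convexHull ℝ (Set.range fun (i : Fin (k + 1)) (m : Fin k) =>
      if m.castSucc < i then (1 : ℝ) else 0) =
      antitoneSimplex k 1 := by
  refine Set.Subset.antisymm (convexHull_min ?_ (convex_antitoneSimplex k 1)) fun t ht => ?_
  · rintro _ ⟨i, rfl⟩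
    refine ⟨fun a b hab => ?_, fun m => ?_⟩
    · dsimp only
      split_ifs with h1 h2 <;> norm_num
      exact h2 ((Fin.castSucc_le_castSucc_iff.2 hab).trans_lt h1)
    · dsimp only
      split_ifs <;> simp
  -- `T` is `t` padded by 1 in front and 0 behind. The drops `T i - T (i + 1)` are the barycentric
  -- coordinates of `t`; they telescope to 1, and those with index above `m` telescope to `t m`.
  · let T : ℕ → ℝ := fun i => if i = 0 then 1 else if h : i - 1 < k then t ⟨i - 1, h⟩ else 0
    have hT : ∀ m : Fin k, T (m + 1) = t m := fun m => by simp [T]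
    have hTk : T (k + 1) = 0 := by simp [T]
    rw [convexHull_range_eq_exists_affineCombination]
    refine ⟨Finset.univ, fun i => T i - T (i + 1), fun i _ => sub_nonneg.2 ?_, ?_, ?_⟩
    · rcases Nat.eq_zero_or_pos (i : ℕ) with h0 | h0
      · rw [h0]
        by_cases hk : 0 < k
        · have := (ht.2 ⟨0, hk⟩).2
          simpa [T, hk] using this
        · simp [T, hk]
      · by_cases hk : (i : ℕ) < k
        · have h1 : i - 1 < k := by omega
          have := ht.1 (show (⟨i - 1, h1⟩ : Fin k) ≤ ⟨i, hk⟩ from by simp)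
          simpa [T, hk, h1, h0.ne'] using this
        · have h1 : i - 1 < k := by omega
          have := (ht.2 ⟨i - 1, h1⟩).1
          simpa [T, hk, h1, h0.ne'] using this
    · rw [Fin.sum_univ_eq_sum_range (fun i => T i - T (i + 1)), Finset.sum_range_sub', hTk]
      simp [T]
    · have hsum : ∑ i : Fin (k + 1), (T i - T (i + 1)) = 1 := by
        rw [Fin.sum_univ_eq_sum_range (fun i => T i - T (i + 1)), Finset.sum_range_sub', hTk]
        simp [T]
      rw [Finset.affineCombination_eq_linear_combination _ _ _ hsum]
      funext m
      rw [Finset.sum_apply]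
      simp only [Pi.smul_apply, smul_eq_mul, mul_ite, mul_one, mul_zero]
      have h1 : ∀ i : Fin (k + 1), (m.castSucc < i) = ((m : ℕ) < i) := fun i => rfl
      simp only [h1]
      rw [Fin.sum_univ_eq_sum_range (fun i => if (m : ℕ) < i then T i - T (i + 1) else 0),
        ← Finset.sum_filter]
      have h2 : (Finset.range (k + 1)).filter (fun i => (m : ℕ) < i) =
          Finset.Ico ((m : ℕ) + 1) (k + 1) := by
        ext i
        simp only [Finset.mem_filter, Finset.mem_range, Finset.mem_Ico]
        omega
      rw [h2, Finset.sum_Ico_eq_sum_range]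
      have h3 := Finset.sum_range_sub' (fun i => T (m + 1 + i)) (k + 1 - (m + 1))
      simp only [add_assoc] at h3 ⊢
      rw [h3]
      have h4 : (m : ℕ) + (1 + (k + 1 - (m + 1))) = k + 1 := by have := m.2; omega
      rw [h4, hTk]
      simp [hT m]

/-- The `k`-dimensional volume of a simplex in terms of its successive edges. -/
theorem euclideanHausdorffMeasure_convexHull_range {V : Type*} [NormedAddCommGroup V]
    [InnerProductSpace ℝ V] [MeasurableSpace V] [BorelSpace V] {k : ℕ}
    (v : Fin (k + 1) → V) :
    μHE[k] (convexHull ℝ (Set.range v)) =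
      ENNReal.ofReal √(Matrix.gram ℝ fun m : Fin k => v m.succ - v m.castSucc).det /
        (k ! : ℝ≥0∞) := by
  set e : Fin k → V := fun m => v m.succ - v m.castSucc with he
  let b := EuclideanSpace.basisFun (Fin k) ℝ
  let L : EuclideanSpace ℝ (Fin k) →ₗ[ℝ] V := b.toBasis.constr ℝ e
  have hL : ∀ m, L (b m) = e m := fun m => by
    simp [L]
  -- The staircase vertices differ successively by basis vectors, which `L` sends to the edges, so
  -- the simplex is a translate of the `L`-image of the antitone simplex.
  let u : Fin (k + 1) → EuclideanSpace ℝ (Fin k) :=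
    fun i => WithLp.toLp 2 fun m => if m.castSucc < i then 1 else 0
  have hu : ∀ i, v i = v 0 + L (u i) := by
    intro i
    induction i using Fin.induction with
    | zero =>
      have : u 0 = 0 := by ext m; simp [u]
      rw [this]; simp
    | succ i ih =>
      have : u i.succ = u i.castSucc + b i := by
        ext m
        simp only [u, b, PiLp.add_apply, EuclideanSpace.basisFun_apply, PiLp.single_apply,
          Fin.castSucc_lt_castSucc_iff, Fin.castSucc_lt_succ_iff]
        rcases lt_trichotomy m i with h | h | h
        · simp [h, h.le, h.ne]
        · simp [h]
        · simp [h.not_ge, h.not_gt, h.ne']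
      rw [this, map_add, hL, ← add_assoc, ← ih]
      simp [he]
  have hset : convexHull ℝ (Set.range v) =
      (fun x => v 0 + x) '' (L '' (WithLp.ofLp ⁻¹' antitoneSimplex k 1)) := by
    have h1 : (WithLp.ofLp ⁻¹' antitoneSimplex k 1 : Set (EuclideanSpace ℝ (Fin k))) =
        convexHull ℝ (Set.range u) := by
      have h2 : Set.range u = (WithLp.linearEquiv 2 ℝ (Fin k → ℝ)).symm.toLinearMap ''
          (Set.range fun (i : Fin (k + 1)) (m : Fin k) =>
          if m.castSucc < i then (1 : ℝ) else 0) := by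
        rw [← Set.range_comp]; rfl
      rw [h2, ← LinearMap.image_convexHull, convexHull_staircase]
      ext x
      simp only [Set.mem_preimage, Set.mem_image]
      exact ⟨fun h => ⟨_, h, rfl⟩, by rintro ⟨y, hy, rfl⟩; exact hy⟩
    rw [h1, LinearMap.image_convexHull, ← Set.range_comp]
    have h3 := AffineMap.image_convexHull
      (AffineMap.const ℝ V (v 0) + (AffineMap.id ℝ V : V →ᵃ[ℝ] V)) (Set.range (L ∘ u))
    have h4 : ⇑(AffineMap.const ℝ V (v 0) + (AffineMap.id ℝ V : V →ᵃ[ℝ] V)) = fun x => v 0 + x := by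
      ext x; simp
    rw [h4] at h3
    rw [h3, ← Set.range_comp]
    exact congrArg (fun g => convexHull ℝ (Set.range g)) (funext hu)
  have hiso : Isometry fun x => v 0 + x := isometry_add_left _
  rw [hset, hiso.euclideanHausdorffMeasure_image]
  have hfr : Module.finrank ℝ (EuclideanSpace ℝ (Fin k)) = k := by simp
  have h5 := L.euclideanHausdorffMeasure_image_eq_normDet_mul_volume
    (WithLp.ofLp ⁻¹' antitoneSimplex k 1)
  rw [hfr] at h5
  rw [h5, (PiLp.volume_preserving_ofLp (Fin k)).measure_preimage
    (isClosed_antitoneSimplex _ _).measurableSet.nullMeasurableSet,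
    volume_antitoneSimplex k zero_le_one]
  have h6 := L.normDet_sq_eq_det_gram b
  simp only [hL] at h6
  rw [← h6]
  simp only [RCLike.ofReal_real_eq_id, id]
  rw [Real.sqrt_sq L.normDet_nonneg, one_pow, ENNReal.ofReal_div_of_pos (by positivity),
    ENNReal.ofReal_one, ENNReal.ofReal_natCast, ENNReal.div_eq_inv_mul, ENNReal.div_eq_inv_mul,
    mul_one, mul_comm]

/-! ### Facets of the convex hull of points in general position. -/

/-- The successive differences of the points with indices `a 0, a 1, …`. -/
def edges {V : Type*} [AddCommGroup V] {r : ℕ} (w : ℕ → V) (a : Fin (r + 1) → ℕ) (m : Fin r) : V :=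
  w (a m.succ) - w (a m.castSucc)

/-- Any `r + 2` of the points `w 0, …, w n` are affinely independent. -/
def InGeneralPosition {V : Type*} [AddCommGroup V] [Module ℝ V] (r : ℕ) (w : ℕ → V) (n : ℕ) :
    Prop :=
  ∀ a : Fin (r + 2) → ℕ, StrictMono a → (∀ i, a i ≤ n) → LinearIndependent ℝ (edges w a)

/-- The points with indices in `I` are exactly those among `w 0, …, w n` lying on a supporting
hyperplane. -/
def IsFacet {V : Type*} [AddCommGroup V] [Module ℝ V] (w : ℕ → V) (n : ℕ) (I : Finset ℕ) : Prop :=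
  ∃ f : V →ₗ[ℝ] ℝ, f ≠ 0 ∧ ∃ c, (∀ i ∈ I, f (w i) = c) ∧ ∀ i ≤ n, i ∉ I → f (w i) < c

section Geometry

variable {V : Type*} [NormedAddCommGroup V] [InnerProductSpace ℝ V]

/-- Among `r + 2` points on a hyperplane the `r + 1` edges are independent, so they span the space;
a form vanishing on all of them is zero. -/
theorem InGeneralPosition.card_le [FiniteDimensional ℝ V] {r : ℕ} (hV : Module.finrank ℝ V = r + 1)
    {w : ℕ → V} {n : ℕ} (hw : InGeneralPosition r w n) {f : V →ₗ[ℝ] ℝ} (hf : f ≠ 0) {c : ℝ}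
    {A : Finset ℕ} (hA : ∀ i ∈ A, i ≤ n) (hAc : ∀ i ∈ A, f (w i) = c) : A.card ≤ r + 1 := by
  by_contra! h
  obtain ⟨B, hBA, hB⟩ := Finset.exists_subset_card_eq (show r + 2 ≤ A.card from h)
  let a := B.orderEmbOfFin hB
  have ha : ∀ i, a i ∈ B := fun i => B.orderEmbOfFin_mem hB i
  have hli := hw a a.strictMono fun i => hA _ (hBA (ha i))
  have hspan := hli.span_eq_top_of_card_eq_finrank' (by simp [hV])
  apply hf
  refine LinearMap.ker_eq_top.1 (top_le_iff.1 ?_)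
  rw [← hspan, Submodule.span_le]
  rintro _ ⟨m, rfl⟩
  simp [edges, hAc _ (hBA (ha _))]

/-- The deficits `c - f` are nonnegative and average to zero at `z`, so every point with positive
weight has deficit zero. -/
theorem mem_convexHull_face {s : Set V} {z : V} (hz : z ∈ convexHull ℝ s) {f : V →ₗ[ℝ] ℝ} {c : ℝ}
    (hs : ∀ x ∈ s, f x ≤ c) (hfz : f z = c) : z ∈ convexHull ℝ {x ∈ s | f x = c} := by
  obtain ⟨ι, _, g, y, hg, hg1, hy, rfl⟩ := mem_convexHull_iff_exists_fintype.1 hz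
  have h0 : ∑ i, g i * (c - f (y i)) = 0 := by
    simp only [mul_sub, Finset.sum_sub_distrib, ← Finset.sum_mul, hg1, one_mul]
    rw [← hfz, map_sum]
    simp
  have h1 := (Finset.sum_eq_zero_iff_of_nonneg fun i _ =>
    mul_nonneg (hg i) (sub_nonneg.2 (hs _ (hy i)))).1 h0
  have h2 : ∑ i, g i • y i = ∑ i with g i ≠ 0, g i • y i := by
    rw [Finset.sum_filter]
    refine Finset.sum_congr rfl fun i _ => ?_
    split_ifs with h
    · rfl
    · simp [not_not.1 h]
  rw [h2]
  refine (convex_convexHull ℝ _).sum_mem (fun i _ => hg i) ?_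
    fun i hi => subset_convexHull ℝ _ ⟨hy i, ?_⟩
  · rw [← hg1, Finset.sum_filter]
    refine Finset.sum_congr rfl fun i _ => ?_
    split_ifs with h
    · rfl
    · exact (not_not.1 h).symm
  · have := h1 i (Finset.mem_univ i)
    have h3 := (mul_eq_zero.1 this).resolve_left (Finset.mem_filter.1 hi).2
    linarith

/-- At most `k` points span an affine space of dimension below `k`. This discards lower-dimensional
faces and overlaps of facets. -/
theorem euclideanHausdorffMeasure_convexHull_eq_zero [FiniteDimensional ℝ V] [MeasurableSpace V]
    [BorelSpace V] (w : ℕ → V) {k : ℕ} {A : Finset ℕ} (hA : A.card ≤ k) :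
    μHE[k] (convexHull ℝ (w '' A)) = 0 := by
  rcases A.eq_empty_or_nonempty with rfl | hne
  · simp
  · have h1 : dimH (convexHull ℝ (w '' A)) < (k : NNReal) := by
      rw [Real.Convex.dimH_eq_finrank_vectorSpan (convex_convexHull ℝ _)
        ((hne.to_set.image w).mono (subset_convexHull ℝ _)), ← direction_affineSpan,
        affineSpan_convexHull, direction_affineSpan]
      classical
      obtain ⟨m, hm⟩ := Nat.exists_eq_succ_of_ne_zero hne.card_pos.ne'
      have := finrank_vectorSpan_image_finset_le ℝ w A hm
      rw [Finset.coe_image] at this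
      have h2 : Module.finrank ℝ (vectorSpan ℝ (w '' A)) < k := by omega
      exact_mod_cast h2
    rw [Measure.euclideanHausdorffMeasure_def, Measure.smul_apply]
    have := hausdorffMeasure_of_dimH_lt h1
    simp only [NNReal.coe_natCast] at this
    rw [this, smul_zero]

theorem exists_support [FiniteDimensional ℝ V] {K : Set V} (hK : Convex ℝ K)
    (hint : (interior K).Nonempty) {z : V} (hz : z ∉ interior K) :
    ∃ f : V →ₗ[ℝ] ℝ, f ≠ 0 ∧ ∀ x ∈ K, f x ≤ f z := by
  obtain ⟨f, hf⟩ := geometric_hahn_banach_open_point hK.interior isOpen_interior hz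
  refine ⟨f, fun h => ?_, fun x hx => ?_⟩
  · obtain ⟨y, hy⟩ := hint
    have h1 : ∀ v, f v = 0 := fun v => congrArg (fun g : V →ₗ[ℝ] ℝ => g v) h
    have := hf y hy
    simp [h1] at this
  · have h1 : x ∈ closure (interior K) := by
      rw [hK.closure_interior_eq_closure_of_nonempty_interior hint]
      exact subset_closure hx
    have h2 : closure (interior K) ⊆ {x | f x ≤ f z} :=
      closure_minimal (fun y hy => (hf y hy).le) (isClosed_le f.continuous continuous_const)
    exact h2 h1

/-- With `f v ≠ 0`, a small move from `z` along `f v • v` increases `f`, so it must leave `K`. -/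
theorem notMem_interior_of_support {K : Set V} {f : V →ₗ[ℝ] ℝ} (hf : f ≠ 0) {z : V}
    (hz : ∀ x ∈ K, f x ≤ f z) : z ∉ interior K := by
  intro hzi
  obtain ⟨v, hv⟩ := DFunLike.ne_iff.1 hf
  have hv' : f v ≠ 0 := hv
  have hc : Continuous fun t : ℝ => z + (t * f v) • v := by fun_prop
  have h1 : ∀ᶠ t in nhds (0 : ℝ), z + (t * f v) • v ∈ K := by
    have : z + ((0 : ℝ) * f v) • v ∈ interior K := by simpa
    exact (hc.continuousAt.eventually (isOpen_interior.mem_nhds this)).mono fun t ht =>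
      interior_subset ht
  have h2 : ∀ᶠ t in nhdsWithin (0 : ℝ) (Set.Ioi 0), z + (t * f v) • v ∈ K :=
    h1.filter_mono nhdsWithin_le_nhds
  obtain ⟨t, ht, ht0⟩ := (h2.and self_mem_nhdsWithin).exists
  have := hz _ ht
  simp only [map_add, map_smul, smul_eq_mul] at this
  have h3 : 0 < t * (f v * f v) := mul_pos ht0 (mul_self_pos.2 hv')
  linarith

variable [FiniteDimensional ℝ V]

/-- Otherwise all `n + 1 > r + 1` points would lie on one hyperplane. -/
theorem InGeneralPosition.interior_nonempty {r : ℕ} (hV : Module.finrank ℝ V = r + 1)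
    {w : ℕ → V} {n : ℕ} (hw : InGeneralPosition r w n) (hn : r + 1 ≤ n) :
    (interior (convexHull ℝ (w '' Set.Iic n))).Nonempty := by
  rw [interior_convexHull_nonempty_iff_affineSpan_eq_top]
  by_contra h
  have hd : (affineSpan ℝ (w '' Set.Iic n)).direction < ⊤ := by
    refine lt_top_iff_ne_top.2 fun hd => h ?_
    refine (AffineSubspace.direction_eq_top_iff_of_nonempty ?_).1 hd
    exact ⟨w 0, subset_affineSpan ℝ _ ⟨0, by simp, rfl⟩⟩
  obtain ⟨f, hf, hker⟩ := Submodule.exists_le_ker_of_lt_top _ hd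
  have := hw.card_le hV hf (A := Finset.range (n + 1)) (c := f (w 0))
    (fun i hi => by simpa [Nat.lt_succ_iff] using hi)
    (fun i hi => ?_)
  · simp at this
    omega
  · have h1 : w i -ᵥ w 0 ∈ (affineSpan ℝ (w '' Set.Iic n)).direction :=
      AffineSubspace.vsub_mem_direction
        (subset_affineSpan ℝ _ ⟨i, by simpa [Nat.lt_succ_iff] using hi, rfl⟩)
        (subset_affineSpan ℝ _ ⟨0, by simp, rfl⟩)
    have h2 := hker h1
    simpa [sub_eq_zero] using h2

open Classical in
/-- Surface area of the convex hull of points in general position. -/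
theorem InGeneralPosition.measure_frontier [MeasurableSpace V] [BorelSpace V] {r : ℕ}
    (hV : Module.finrank ℝ V = r + 1) {w : ℕ → V} {n : ℕ} (hw : InGeneralPosition r w n)
    (hn : r + 1 ≤ n) :
    μHE[r] (frontier (convexHull ℝ (w '' Set.Iic n))) =
      ∑ I ∈ (Finset.range (n + 1)).powersetCard (r + 1),
        if IsFacet w n I then μHE[r] (convexHull ℝ (w '' I)) else 0 := by
  set K := convexHull ℝ (w '' Set.Iic n) with hK
  set F := ((Finset.range (n + 1)).powersetCard (r + 1)).filter (IsFacet w n) with hF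
  rw [← Finset.sum_filter, ← hF]
  have hKc : IsCompact K := ((Set.finite_Iic n).image w).isCompact_convexHull (𝕜 := ℝ)
  have hFsub : ∀ I ∈ F, w '' I ⊆ w '' Set.Iic n := fun I hI => by
    refine Set.image_mono fun i hi => ?_
    have := (Finset.mem_powersetCard.1 (Finset.mem_filter.1 hI).1).1 hi
    simpa [Nat.lt_succ_iff] using this
  have hcompact : ∀ I : Finset ℕ, IsCompact (convexHull ℝ (w '' I)) := fun I =>
    (I.finite_toSet.image w).isCompact_convexHull (𝕜 := ℝ)
  -- a point of a facet lying in another sub-hull uses only common vertices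
  have hface : ∀ I ∈ F, ∀ J : Finset ℕ, (∀ i ∈ J, i ≤ n) →
      convexHull ℝ (w '' I) ∩ convexHull ℝ (w '' J) ⊆ convexHull ℝ (w '' (I ∩ J : Finset ℕ)) := by
    rintro I hI J hJ z ⟨hzI, hzJ⟩
    obtain ⟨f, hf, c, hc, hlt⟩ := (Finset.mem_filter.1 hI).2
    have hfz : f z = c := by
      have : convexHull ℝ (w '' I) ⊆ {x | f x = c} :=
        convexHull_min (by rintro _ ⟨i, hi, rfl⟩; exact hc i hi) (convex_hyperplane f.isLinear c)
      exact this hzI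
    have h1 := mem_convexHull_face hzJ (f := f) (c := c) (by
      rintro _ ⟨i, hi, rfl⟩
      by_cases hiI : i ∈ I
      · exact (hc i hiI).le
      · exact (hlt i (hJ i hi) hiI).le) hfz
    refine convexHull_mono ?_ h1
    rintro _ ⟨⟨i, hi, rfl⟩, hfi⟩
    refine ⟨i, ?_, rfl⟩
    rw [Finset.mem_coe, Finset.mem_inter]
    refine ⟨?_, hi⟩
    by_contra hiI
    exact (hlt i (hJ i hi) hiI).ne hfi
  -- Two distinct facets share at most `r` vertices, and they meet only in the hull of these.
  have hdisj : (F : Set (Finset ℕ)).Pairwise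
      (Function.onFun (AEDisjoint μHE[r]) fun I => convexHull ℝ (w '' I)) := by
    intro I hI J hJ hne
    have hIc := (Finset.mem_powersetCard.1 (Finset.mem_filter.1 hI).1)
    have hJc := (Finset.mem_powersetCard.1 (Finset.mem_filter.1 hJ).1)
    refine measure_mono_null (hface I hI J fun i hi => by
      simpa [Nat.lt_succ_iff] using hJc.1 hi) ?_
    refine euclideanHausdorffMeasure_convexHull_eq_zero w ?_
    by_contra! hlt
    have h1 : I ∩ J = I := Finset.eq_of_subset_of_card_le Finset.inter_subset_left (by omega)
    have h2 : I ∩ J = J := Finset.eq_of_subset_of_card_le Finset.inter_subset_right (by omega)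
    exact hne (h1.symm.trans h2)
  rw [← measure_biUnion_finset₀ hdisj fun I _ => (hcompact I).measurableSet.nullMeasurableSet]
  refine le_antisymm ?_ (measure_mono ?_)
  -- A supporting hyperplane at a boundary point contains at most `r + 1` of the points: exactly `r
  -- + 1` give a facet, fewer give a null set collected in `N`.
  · set N := (Finset.range (n + 1)).powerset.filter fun A => A.card ≤ r with hN
    have hnull : μHE[r] (⋃ A ∈ N, convexHull ℝ (w '' A)) = 0 :=
      (measure_biUnion_null_iff N.countable_toSet).2 fun A hA =>
        euclideanHausdorffMeasure_convexHull_eq_zero w (Finset.mem_filter.1 hA).2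
    have hsub : frontier K ⊆ (⋃ I ∈ F, convexHull ℝ (w '' I)) ∪ ⋃ A ∈ N, convexHull ℝ (w '' A) := by
      intro z hz
      rw [hKc.isClosed.frontier_eq] at hz
      obtain ⟨f, hf, hfz⟩ := exists_support (convex_convexHull ℝ _)
        (hw.interior_nonempty hV hn) hz.2
      have hle : ∀ i ≤ n, f (w i) ≤ f z := fun i hi =>
        hfz _ (subset_convexHull ℝ _ ⟨i, hi, rfl⟩)
      have h1 := mem_convexHull_face hz.1 (f := f) (c := f z) (by
        rintro _ ⟨i, hi, rfl⟩; exact hle i hi) rfl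
      set A := (Finset.range (n + 1)).filter fun i => f (w i) = f z with hA
      have h2 : z ∈ convexHull ℝ (w '' A) := by
        refine convexHull_mono ?_ h1
        rintro _ ⟨⟨i, hi, rfl⟩, hfi⟩
        exact ⟨i, by simpa [hA, Nat.lt_succ_iff] using ⟨hi, hfi⟩, rfl⟩
      have hAn : ∀ i ∈ A, i ≤ n := fun i hi => by
        simpa [Nat.lt_succ_iff] using (Finset.mem_filter.1 hi).1
      have hcard := hw.card_le hV hf hAn fun i hi => (Finset.mem_filter.1 hi).2
      rcases hcard.lt_or_eq with hlt | heq
      · right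
        refine Set.mem_biUnion (x := A) ?_ h2
        exact Finset.mem_filter.2 ⟨Finset.mem_powerset.2 (Finset.filter_subset _ _),
          Nat.lt_succ_iff.1 hlt⟩
      · left
        refine Set.mem_biUnion (x := A) ?_ h2
        refine Finset.mem_filter.2 ⟨Finset.mem_powersetCard.2 ⟨Finset.filter_subset _ _, heq⟩,
          f, hf, f z, fun i hi => (Finset.mem_filter.1 hi).2, fun i hi hiA => ?_⟩
        refine lt_of_le_of_ne (hle i hi) fun h => hiA ?_
        exact Finset.mem_filter.2 ⟨Finset.mem_range.2 (Nat.lt_succ_iff.2 hi), h⟩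
    calc μHE[r] (frontier K) ≤ _ := measure_mono hsub
      _ ≤ _ := measure_union_le _ _
      _ = _ := by rw [hnull, add_zero]
  · refine Set.iUnion₂_subset fun I hI z hz => ?_
    rw [hKc.isClosed.frontier_eq]
    refine ⟨convexHull_mono (hFsub I hI) hz, ?_⟩
    obtain ⟨f, hf, c, hc, hlt⟩ := (Finset.mem_filter.1 hI).2
    have hfz : f z = c := by
      have : convexHull ℝ (w '' I) ⊆ {x | f x = c} :=
        convexHull_min (by rintro _ ⟨i, hi, rfl⟩; exact hc i hi) (convex_hyperplane f.isLinear c)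
      exact this hz
    refine notMem_interior_of_support hf fun x hx => ?_
    rw [hfz]
    have : K ⊆ {x | f x ≤ c} := by
      refine convexHull_min ?_ (convex_halfSpace_le f.isLinear c)
      rintro _ ⟨i, hi, rfl⟩
      by_cases hiI : i ∈ I
      · exact (hc i hiI).le
      · exact (hlt i hi hiI).le
    exact this hx

end Geometry

/-! ### Facets detected by the sign of a determinant. -/

/-- The linear form `v ↦ det (v, e 0, …, e (k - 1))`. -/
def normalForm {k : ℕ} (e : Fin k → EuclideanSpace ℝ (Fin (k + 1))) :
    EuclideanSpace ℝ (Fin (k + 1)) →ₗ[ℝ] ℝ where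
  toFun v := (Matrix.detRowAlternating (n := Fin (k + 1)) (R := ℝ))
    (Matrix.vecCons v.ofLp fun m => (e m).ofLp)
  map_add' u v := by rw [WithLp.ofLp_add, AlternatingMap.map_vecCons_add]
  map_smul' c v := by rw [WithLp.ofLp_smul, AlternatingMap.map_vecCons_smul]; rfl

section NormalForm

variable {k : ℕ} {e : Fin k → EuclideanSpace ℝ (Fin (k + 1))}

theorem normalForm_apply (v : EuclideanSpace ℝ (Fin (k + 1))) :
    normalForm e v = (Matrix.of (Matrix.vecCons v.ofLp fun m => (e m).ofLp)).det := rfl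

theorem normalForm_edge (m : Fin k) : normalForm e (e m) = 0 := by
  refine AlternatingMap.map_eq_zero_of_eq (Matrix.detRowAlternating (n := Fin (k + 1)) (R := ℝ)) _
    (i := 0) (j := m.succ) ?_ (Fin.succ_ne_zero m).symm
  simp

theorem normalForm_ne_zero_iff {v : EuclideanSpace ℝ (Fin (k + 1))} :
    normalForm e v ≠ 0 ↔
      LinearIndependent ℝ (Fin.cons v e : Fin (k + 1) → EuclideanSpace ℝ (Fin (k + 1))) := by
  rw [normalForm_apply, ← isUnit_iff_ne_zero, ← Matrix.isUnit_iff_isUnit_det,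
    ← Matrix.linearIndependent_rows_iff_isUnit,
    ← (WithLp.linearEquiv 2 ℝ (Fin (k + 1) → ℝ)).toLinearMap.linearIndependent_iff (by simp)]
  have : (Matrix.of (Matrix.vecCons v.ofLp fun m => (e m).ofLp)).row =
      (WithLp.linearEquiv 2 ℝ (Fin (k + 1) → ℝ)).toLinearMap ∘
        (Fin.cons v e : Fin (k + 1) → EuclideanSpace ℝ (Fin (k + 1))) := by
    funext i
    refine Fin.cases ?_ (fun i => ?_) i <;> rfl
  rw [this]

/-- The forms vanishing on `k` independent vectors of a `(k + 1)`-dimensional space are all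
proportional; stated by cross-multiplication to avoid choosing a nonzero form. -/
theorem apply_mul_apply_eq {e : Fin k → EuclideanSpace ℝ (Fin (k + 1))} (he : LinearIndependent ℝ e)
    {f g : EuclideanSpace ℝ (Fin (k + 1)) →ₗ[ℝ] ℝ} (hf : ∀ m, f (e m) = 0) (hg : ∀ m, g (e m) = 0)
    (u v : EuclideanSpace ℝ (Fin (k + 1))) : f u * g v = f v * g u := by
  by_cases hu : u ∈ Submodule.span ℝ (Set.range e)
  · have h : ∀ h : EuclideanSpace ℝ (Fin (k + 1)) →ₗ[ℝ] ℝ, (∀ m, h (e m) = 0) → h u = 0 := by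
      intro h hh
      have : Submodule.span ℝ (Set.range e) ≤ h.ker := by
        rw [Submodule.span_le]
        rintro _ ⟨m, rfl⟩
        exact hh m
      exact this hu
    rw [h f hf, h g hg, zero_mul, mul_zero]
  · have hli := linearIndependent_finCons.2 ⟨he, hu⟩
    have hspan := hli.span_eq_top_of_card_eq_finrank' (by simp)
    have h0 : (f u • g - g u • f).ker = ⊤ := by
      rw [← top_le_iff, ← hspan, Submodule.span_le]
      rintro _ ⟨m, rfl⟩
      refine Fin.cases ?_ (fun m => ?_) m
      · simp [mul_comm]
      · simp [hf, hg]
    have h1 : v ∈ (f u • g - g u • f).ker := h0 ▸ Submodule.mem_top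
    simp only [LinearMap.mem_ker, LinearMap.sub_apply, LinearMap.smul_apply, smul_eq_mul] at h1
    linarith

end NormalForm

/-- All points of the walk other than those with indices in the range of `a` lie strictly on the
positive side (with respect to `s • normalForm`) of the hyperplane through the points indexed by
`a`. -/
def LiesAbove {k : ℕ} (s : ℝ) (w : ℕ → EuclideanSpace ℝ (Fin (k + 1))) (n : ℕ)
    (a : Fin (k + 1) → ℕ) : Prop :=
  ∀ p ≤ n, p ∉ Set.range a → 0 < s * normalForm (edges w a) (w p - w (a 0))

section Facets

variable {k : ℕ} {w : ℕ → EuclideanSpace ℝ (Fin (k + 1))} {n : ℕ} {a : Fin (k + 1) → ℕ}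

theorem apply_vertex_eq {V : Type*} [AddCommGroup V] [Module ℝ V] {w : ℕ → V}
    {f : V →ₗ[ℝ] ℝ} (hf : ∀ m, f (edges w a m) = 0) (l : Fin (k + 1)) :
    f (w (a l)) = f (w (a 0)) := by
  induction l using Fin.induction with
  | zero => rfl
  | succ l ih =>
    have := hf l
    rw [edges, map_sub, sub_eq_zero] at this
    rw [this, ih]

/-- If the determinant vanished, one hyperplane would contain the `k + 1` marked points together
with the `p`-th, against `InGeneralPosition.card_le`. -/
theorem InGeneralPosition.normalForm_ne_zero (hw : InGeneralPosition k w n) (ha : StrictMono a)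
    (han : ∀ l, a l ≤ n) {p : ℕ} (hp : p ≤ n) (hpa : p ∉ Set.range a) :
    normalForm (edges w a) (w p - w (a 0)) ≠ 0 := by
  rw [normalForm_ne_zero_iff]
  by_contra hli
  have hlt : Submodule.span ℝ (Set.range (Fin.cons (w p - w (a 0)) (edges w a) :
      Fin (k + 1) → EuclideanSpace ℝ (Fin (k + 1)))) < ⊤ := by
    rw [lt_top_iff_ne_top]
    intro h
    exact hli (linearIndependent_of_top_le_span_of_card_eq_finrank h.ge (by simp))
  obtain ⟨f, hf, hker⟩ := Submodule.exists_le_ker_of_lt_top _ hlt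
  rw [Submodule.span_le] at hker
  have h0 : f (w p - w (a 0)) = 0 := hker ⟨0, rfl⟩
  have h1 : ∀ m, f (edges w a m) = 0 := fun m => hker ⟨m.succ, rfl⟩
  have h2 := hw.card_le (by simp) hf (A := insert p (Finset.univ.image a)) (c := f (w (a 0)))
    (by
      intro i hi
      rcases Finset.mem_insert.1 hi with rfl | hi
      · exact hp
      · obtain ⟨l, -, rfl⟩ := Finset.mem_image.1 hi
        exact han l)
    (by
      intro i hi
      rcases Finset.mem_insert.1 hi with rfl | hi
      · rwa [map_sub, sub_eq_zero] at h0
      · obtain ⟨l, -, rfl⟩ := Finset.mem_image.1 hi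
        exact apply_vertex_eq h1 l)
  rw [Finset.card_insert_of_notMem (by simpa using hpa),
    Finset.card_image_of_injective _ ha.injective]
    at h2
  simp at h2

theorem exists_notMem_range (a : Fin (k + 1) → ℕ) (hn : k + 1 ≤ n) : ∃ p ≤ n, p ∉ Set.range a := by
  by_contra! h
  have h1 : Finset.range (n + 1) ⊆ Finset.univ.image a := fun p hp => by
    simpa using h p (Nat.lt_succ_iff.1 (Finset.mem_range.1 hp))
  have h2 := (Finset.card_le_card h1).trans Finset.card_image_le
  simp at h2
  omega

/-- At least one point is unmarked because `n + 1 > k + 1`. Exclusiveness lets the contributions of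
the two sides be added. -/
theorem not_liesAbove_both (hn : k + 1 ≤ n) (h1 : LiesAbove 1 w n a) : ¬ LiesAbove (-1) w n a := by
  intro h2
  obtain ⟨p, hp, hpa⟩ := exists_notMem_range a hn
  have := h1 p hp hpa
  have := h2 p hp hpa
  linarith

theorem InGeneralPosition.isFacet_iff (hw : InGeneralPosition k w n) (hn : k + 1 ≤ n)
    (ha : StrictMono a) (han : ∀ l, a l ≤ n) :
    IsFacet w n (Finset.univ.image a) ↔ LiesAbove 1 w n a ∨ LiesAbove (-1) w n a := by
  obtain ⟨p₀, hp₀, hpa₀⟩ := exists_notMem_range a hn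
  have hν := hw.normalForm_ne_zero ha han hp₀ hpa₀
  constructor
  · rintro ⟨f, hf, c, hc, hlt⟩
    have hc' : ∀ l, f (w (a l)) = c := fun l => hc _ (by simp)
    have hfe : ∀ m, f (edges w a m) = 0 := fun m => by simp [edges, hc']
    have hli : LinearIndependent ℝ (edges w a) :=
      (linearIndependent_finCons.1 (normalForm_ne_zero_iff.1 hν)).1
    have hneg : ∀ p ≤ n, p ∉ Set.range a → f (w p - w (a 0)) < 0 := fun p hp hpa => by
      rw [map_sub, hc', sub_neg]
      exact hlt p hp (by simpa using hpa)
    -- The supporting form is a multiple of the normal form, and the sign of the latter at `p₀`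
    -- decides which alternative holds.
    have hprop : ∀ v, f (w p₀ - w (a 0)) * normalForm (edges w a) v =
        f v * normalForm (edges w a) (w p₀ - w (a 0)) := fun v =>
      apply_mul_apply_eq hli hfe (fun m => normalForm_edge m) _ v
    rcases hν.lt_or_gt with h | h
    · right
      intro p hp hpa
      have h1 := hprop (w p - w (a 0))
      have h2 := mul_pos_of_neg_of_neg (hneg p hp hpa) h
      have h3 := hneg p₀ hp₀ hpa₀
      rw [← h1] at h2
      have := neg_of_mul_pos_right h2 h3.le
      linarith
    · left
      intro p hp hpa
      have h1 := hprop (w p - w (a 0))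
      have h2 := mul_neg_of_neg_of_pos (hneg p hp hpa) h
      have h3 := hneg p₀ hp₀ hpa₀
      rw [← h1] at h2
      have := pos_of_mul_neg_right h2 h3.le
      linarith
  · have key : ∀ s : ℝ, LiesAbove s w n a → IsFacet w n (Finset.univ.image a) := by
      intro s hs
      have hpos := hs p₀ hp₀ hpa₀
      -- `IsFacet` wants the other points below the hyperplane while `LiesAbove` puts them above,
      -- hence the minus sign.
      refine ⟨-(s • normalForm (edges w a)), fun h => ?_, -(s * normalForm (edges w a) (w (a 0))),
        fun i hi => ?_, fun p hp hpa => ?_⟩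
      · have := congrArg (fun g => g (w p₀ - w (a 0))) h
        simp only [LinearMap.neg_apply, LinearMap.smul_apply, smul_eq_mul,
          LinearMap.zero_apply] at this
        linarith
      · obtain ⟨l, -, rfl⟩ := Finset.mem_image.1 hi
        simp [apply_vertex_eq (fun m => normalForm_edge m) l]
      · have := hs p hp (by simpa using hpa)
        rw [map_sub] at this
        simp only [LinearMap.neg_apply, LinearMap.smul_apply, smul_eq_mul]
        linarith
    rintro (h | h)
    exacts [key _ h, key _ h]

end Facets

/-! ### Vertex sets encoded by a first index and gaps. -/

/-- The starting position of the `m`-th of consecutive blocks of lengths `j 0, j 1, …`. -/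
def blockStart {k : ℕ} (j : Fin k → ℕ) (m : ℕ) : ℕ :=
  ∑ l : Fin k with l.val < m, j l

/-- The end points of consecutive blocks of lengths `j 0, j 1, …`, the first block starting
at `i`. -/
def vertexIndex {k : ℕ} (j : Fin k → ℕ) (i : ℕ) (l : Fin (k + 1)) : ℕ :=
  i + blockStart j l

section Blocks

variable {k : ℕ} {j : Fin k → ℕ}

@[simp]
theorem blockStart_zero : blockStart j 0 = 0 := by simp [blockStart]

theorem blockStart_succ (m : Fin k) : blockStart j (m + 1) = blockStart j m + j m := by
  have : (Finset.univ.filter fun l : Fin k => l.val < m + 1) =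
      insert m (Finset.univ.filter fun l : Fin k => l.val < m) := by
    ext l
    simp [Fin.ext_iff]
    omega
  rw [blockStart, this, Finset.sum_insert (by simp), add_comm, blockStart]

theorem blockStart_last : blockStart j k = ∑ m, j m := by simp [blockStart]

theorem blockStart_mono : Monotone (blockStart j) := fun m m' h =>
  Finset.sum_le_sum_of_subset fun l hl => by
    simp only [Finset.mem_filter, Finset.mem_univ, true_and] at hl ⊢
    omega

theorem blockStart_le (m : ℕ) : blockStart j m ≤ ∑ m, j m :=
  Finset.sum_le_sum_of_subset (Finset.filter_subset _ _)

theorem vertexIndex_zero (i : ℕ) : vertexIndex j i 0 = i := by simp [vertexIndex]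

theorem vertexIndex_succ (i : ℕ) (m : Fin k) :
    vertexIndex j i m.succ = vertexIndex j i m.castSucc + j m := by
  simp [vertexIndex, blockStart_succ, add_assoc]

theorem vertexIndex_le (i : ℕ) (l : Fin (k + 1)) : vertexIndex j i l ≤ i + ∑ m, j m :=
  Nat.add_le_add_left (blockStart_le _) _

theorem vertexIndex_strictMono (hj : ∀ m, 1 ≤ j m) (i : ℕ) : StrictMono (vertexIndex j i) :=
  Fin.strictMono_iff_lt_succ.2 fun m => by
    have := hj m
    rw [vertexIndex_succ]
    omega

theorem eq_vertexIndex {a : Fin (k + 1) → ℕ} (ha : Monotone a) :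
    a = vertexIndex (fun m => a m.succ - a m.castSucc) (a 0) := by
  funext l
  induction l using Fin.induction with
  | zero => rw [vertexIndex_zero]
  | succ l ih =>
    rw [vertexIndex_succ, ← ih]
    have := ha (Fin.castSucc_lt_succ (i := l)).le
    omega

/-- An index set listed increasingly is determined by its first element and its gaps; the last
element is `i + ∑ j ≤ n`, which bounds `i`. -/
theorem sum_powersetCard_eq {M : Type*} [AddCommMonoid M] (k n : ℕ) (h : Finset ℕ → M) :
    ∑ I ∈ (Finset.range (n + 1)).powersetCard (k + 1), h I =
      ∑ j ∈ stepTuples k n, ∑ i ∈ Finset.range (n - ∑ m, j m + 1),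
        h (Finset.univ.image (vertexIndex j i)) := by
  rw [Finset.sum_sigma']
  symm
  refine Finset.sum_bij (fun x _ => Finset.univ.image (vertexIndex x.1 x.2)) ?_ ?_ ?_ ?_
  · rintro ⟨j, i⟩ hx
    simp only [Finset.mem_sigma, mem_stepTuples, Finset.mem_range] at hx
    refine Finset.mem_powersetCard.2 ⟨fun p hp => ?_, ?_⟩
    · obtain ⟨l, -, rfl⟩ := Finset.mem_image.1 hp
      have := vertexIndex_le (j := j) i l
      dsimp only
      rw [Finset.mem_range]
      omega
    · rw [Finset.card_image_of_injective _ (vertexIndex_strictMono hx.1.1 i).injective]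
      simp
  · rintro ⟨j, i⟩ hx ⟨j', i'⟩ hx' heq
    simp only [Finset.mem_sigma, mem_stepTuples, Finset.mem_range] at hx hx'
    have h1 : vertexIndex j i = vertexIndex j' i' := by
      refine ((vertexIndex_strictMono hx.1.1 i).range_inj (vertexIndex_strictMono hx'.1.1 i')).1 ?_
      have := congrArg (fun s : Finset ℕ => (s : Set ℕ)) heq
      simpa using this
    have h2 : i = i' := by
      have := congrFun h1 0
      rwa [vertexIndex_zero, vertexIndex_zero] at this
    have h3 : j = j' := by
      funext m
      have := congrFun h1 m.succ
      rw [vertexIndex_succ, vertexIndex_succ, congrFun h1 m.castSucc] at this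
      omega
    rw [h2, h3]
  · intro I hI
    obtain ⟨hIn, hIc⟩ := Finset.mem_powersetCard.1 hI
    let a := I.orderEmbOfFin hIc
    have hv := eq_vertexIndex (a := a) a.monotone
    have hmono : ∀ m : Fin k, a m.castSucc < a m.succ := fun m =>
      a.strictMono Fin.castSucc_lt_succ
    have hlast : ∑ m : Fin k, (a m.succ - a m.castSucc) + a 0 ≤ n := by
      have h1 := congrFun hv (Fin.last k)
      rw [vertexIndex, Fin.val_last, blockStart_last] at h1
      have h2 := hIn (I.orderEmbOfFin_mem hIc (Fin.last k))
      have h3 : a (Fin.last k) < n + 1 := Finset.mem_range.1 h2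
      omega
    refine ⟨⟨fun m => a m.succ - a m.castSucc, a 0⟩, ?_, ?_⟩
    · simp only [Finset.mem_sigma, mem_stepTuples, Finset.mem_range]
      refine ⟨⟨fun m => ?_, ?_⟩, ?_⟩
      · have := hmono m
        omega
      · omega
      · omega
    · dsimp only
      rw [← hv]
      exact Finset.image_orderEmbOfFin_univ _ hIc
  · intro _ _
    rfl

end Blocks

/-! ### Rearrangements of the steps: moving and rotating blocks. -/

/-- The partial sums of a sequence. -/
def partialSum {V : Type*} [AddCommMonoid V] (x : ℕ → V) (p : ℕ) : V :=
  ∑ i ∈ Finset.range p, x i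

section PartialSum

variable {V : Type*} [AddCommGroup V] (x : ℕ → V)

@[simp]
theorem partialSum_zero : partialSum x 0 = 0 := by simp [partialSum]

theorem partialSum_succ (p : ℕ) : partialSum x (p + 1) = partialSum x p + x p :=
  Finset.sum_range_succ _ _

theorem edges_partialSum {r : ℕ} {a : Fin (r + 1) → ℕ} (ha : Monotone a) (m : Fin r) :
    edges (partialSum x) a m = ∑ p ∈ Finset.Ico (a m.castSucc) (a m.succ), x p := by
  rw [Finset.sum_Ico_eq_sub _ (ha Fin.castSucc_lt_succ.le)]
  rfl

/-- The injection moving the block of positions `[i, i + J)` to the front. -/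
def gather (J i p : ℕ) : ℕ :=
  if p < i then J + p else if p < i + J then p - i else p

theorem gather_injective (J i : ℕ) : Function.Injective (gather J i) := by
  intro p q h
  unfold gather at h
  split_ifs at h <;> omega

-- The gathered walk first makes the `i` steps following the initial `J`, then those `J` steps, and
-- from time `J + i` on agrees with the original walk. This and the next two lemmas treat the three
-- ranges.
variable {x} in
theorem partialSum_gather_of_le {J i p : ℕ} (hp : p ≤ i) :
    partialSum (x ∘ gather J i) p = partialSum x (J + p) - partialSum x J := by
  induction p with
  | zero => simp
  | succ p ih =>
    rw [partialSum_succ, ih (by omega), ← add_assoc, partialSum_succ]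
    have : gather J i p = J + p := by simp [gather]; omega
    rw [Function.comp_apply, this]
    abel

theorem partialSum_gather_add {J i q : ℕ} (hq : q ≤ J) :
    partialSum (x ∘ gather J i) (i + q) =
      partialSum x (J + i) - partialSum x J + partialSum x q := by
  induction q with
  | zero => simp [partialSum_gather_of_le le_rfl]
  | succ q ih =>
    rw [← add_assoc, partialSum_succ, ih (by omega), partialSum_succ]
    have : gather J i (i + q) = q := by simp [gather]; omega
    rw [Function.comp_apply, this, add_assoc]

theorem partialSum_gather_of_ge {J i q : ℕ} (hq : i ≤ q) :
    partialSum (x ∘ gather J i) (J + q) = partialSum x (J + q) := by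
  induction q, hq using Nat.le_induction with
  | base =>
    rw [add_comm J i, partialSum_gather_add x le_rfl, add_comm J i]
    abel
  | succ q hq ih =>
    rw [← add_assoc, partialSum_succ, ih, partialSum_succ]
    have : gather J i (J + q) = J + q := by
      unfold gather
      split_ifs <;> omega
    rw [Function.comp_apply, this]

end PartialSum

section Rotation

variable {k : ℕ} {j : Fin k → ℕ}

theorem exists_block {p : ℕ} (hp : p < ∑ m, j m) :
    ∃ m : Fin k, ∃ q < j m, p = blockStart j m + q := by
  have key : ∀ l ≤ k, p < blockStart j l → ∃ m : Fin k, ∃ q < j m, p = blockStart j m + q := by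
    intro l
    induction l with
    | zero => simp
    | succ l ih =>
      intro hl hpl
      by_cases h : p < blockStart j l
      · exact ih (by omega) h
      · have := blockStart_succ (j := j) ⟨l, hl⟩
        simp only at this
        exact ⟨⟨l, hl⟩, p - blockStart j l, by omega, by simp only; omega⟩
  exact key k le_rfl (by rwa [blockStart_last])

theorem block_unique {m m' : Fin k} {q q' : ℕ} (hq : q < j m) (hq' : q' < j m')
    (h : blockStart j m + q = blockStart j m' + q') : m = m' := by
  have h1 := blockStart_succ (j := j) m
  have h2 := blockStart_succ (j := j) m'
  rcases lt_trichotomy m m' with hlt | heq | hlt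
  · have := blockStart_mono (j := j) (show (m : ℕ) + 1 ≤ m' from hlt)
    omega
  · exact heq
  · have := blockStart_mono (j := j) (show (m' : ℕ) + 1 ≤ m from hlt)
    omega

theorem block_lt (m : Fin k) {q : ℕ} (hq : q < j m) : blockStart j m + q < ∑ m, j m := by
  have h1 := blockStart_succ (j := j) m
  have h2 := blockStart_le (j := j) (m + 1)
  omega

open Classical in
/-- Cyclic rotation by `c m` inside the `m`-th of consecutive blocks of lengths `j 0, j 1, …`. -/
noncomputable def rotate (j c : Fin k → ℕ) (p : ℕ) : ℕ :=
  if h : ∃ m : Fin k, blockStart j m ≤ p ∧ p < blockStart j m + j m then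
    blockStart j h.choose + (p - blockStart j h.choose + c h.choose) % j h.choose
  else p

theorem rotate_block (c : Fin k → ℕ) (m : Fin k) {q : ℕ} (hq : q < j m) :
    rotate j c (blockStart j m + q) = blockStart j m + (q + c m) % j m := by
  have h : ∃ m' : Fin k, blockStart j m' ≤ blockStart j m + q ∧
      blockStart j m + q < blockStart j m' + j m' := ⟨m, by omega, by omega⟩
  have hm : h.choose = m := by
    have hs := h.choose_spec
    exact (block_unique (q := q) (q' := blockStart j m + q - blockStart j h.choose) hq (by omega)
      (by omega)).symm
  rw [rotate, dif_pos h, hm, Nat.add_sub_cancel_left]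

theorem rotate_of_ge (c : Fin k → ℕ) {p : ℕ} (hp : ∑ m, j m ≤ p) : rotate j c p = p := by
  rw [rotate, dif_neg]
  rintro ⟨m, h1, h2⟩
  have := block_lt (j := j) m (q := p - blockStart j m) (by omega)
  omega

/-- Injectivity is what invariance of the i.i.d. law under reindexing requires. -/
theorem rotate_injective (c : Fin k → ℕ) : Function.Injective (rotate j c) := by
  intro p p' h
  rcases lt_or_ge p (∑ m, j m) with hp | hp <;> rcases lt_or_ge p' (∑ m, j m) with hp' | hp'
  · obtain ⟨m, q, hq, rfl⟩ := exists_block hp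
    obtain ⟨m', q', hq', rfl⟩ := exists_block hp'
    rw [rotate_block c m hq, rotate_block c m' hq'] at h
    obtain rfl := block_unique (Nat.mod_lt _ (by omega)) (Nat.mod_lt _ (by omega)) h
    have h1 : (q + c m) ≡ (q' + c m) [MOD j m] := Nat.add_left_cancel h
    have h2 := Nat.ModEq.add_right_cancel' _ h1
    rw [Nat.ModEq, Nat.mod_eq_of_lt hq, Nat.mod_eq_of_lt hq'] at h2
    rw [h2]
  · obtain ⟨m, q, hq, rfl⟩ := exists_block hp
    rw [rotate_block c m hq, rotate_of_ge c hp'] at h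
    have := block_lt (j := j) m (Nat.mod_lt (q + c m) (by omega))
    omega
  · obtain ⟨m, q, hq, rfl⟩ := exists_block hp'
    rw [rotate_block c m hq, rotate_of_ge c hp] at h
    have := block_lt (j := j) m (Nat.mod_lt (q + c m) (by omega))
    omega
  · rwa [rotate_of_ge c hp, rotate_of_ge c hp'] at h

theorem sum_range_mod {M : Type*} [AddCommMonoid M] (y : ℕ → M) (l c : ℕ) :
    ∑ r ∈ Finset.range l, y ((r + c) % l) = ∑ r ∈ Finset.range l, y r := by
  have hinj : Set.InjOn (fun r => (r + c) % l) (Finset.range l : Set ℕ) := by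
    intro q hq q' hq' h
    simp only [Finset.coe_range, Set.mem_Iio] at hq hq'
    have h2 := Nat.ModEq.add_right_cancel' c (show (q + c) ≡ (q' + c) [MOD l] from h)
    rwa [Nat.ModEq, Nat.mod_eq_of_lt hq, Nat.mod_eq_of_lt hq'] at h2
  have himg : (Finset.range l).image (fun r => (r + c) % l) = Finset.range l := by
    refine Finset.eq_of_subset_of_card_le (fun p hp => ?_) (Finset.card_image_of_injOn hinj).ge
    obtain ⟨r, hr, rfl⟩ := Finset.mem_image.1 hp
    exact Finset.mem_range.2 (Nat.mod_lt _ (by have := Finset.mem_range.1 hr; omega))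
  conv_rhs => rw [← himg]
  rw [Finset.sum_image hinj]

variable {V : Type*} [AddCommGroup V] (x : ℕ → V)

theorem partialSum_rotate_add (c : Fin k → ℕ) (m : Fin k) {q : ℕ} (hq : q ≤ j m) :
    partialSum (x ∘ rotate j c) (blockStart j m + q) =
      partialSum (x ∘ rotate j c) (blockStart j m) +
        ∑ r ∈ Finset.range q, x (blockStart j m + (r + c m) % j m) := by
  induction q with
  | zero => simp
  | succ q ih =>
    rw [← add_assoc, partialSum_succ, ih (by omega), Finset.sum_range_succ, Function.comp_apply,
      rotate_block c m (by omega), add_assoc]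

/-- Rotation permutes the steps within each block, so block totals, and hence the marked points,
stay fixed. -/
theorem partialSum_rotate_blockStart (c : Fin k → ℕ) {l : ℕ} (hl : l ≤ k) :
    partialSum (x ∘ rotate j c) (blockStart j l) = partialSum x (blockStart j l) := by
  induction l with
  | zero => simp
  | succ l ih =>
    have h1 := blockStart_succ (j := j) ⟨l, hl⟩
    have h2 := partialSum_rotate_add x (j := j) c ⟨l, hl⟩ le_rfl
    simp only at h1 h2
    rw [h1, h2, ih (by omega), sum_range_mod (fun r => x (blockStart j l + r))]
    simp only [partialSum]
    rw [Finset.sum_range_add]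

theorem partialSum_rotate_of_ge (c : Fin k → ℕ) {p : ℕ} (hp : ∑ m, j m ≤ p) :
    partialSum (x ∘ rotate j c) p = partialSum x p := by
  induction p, hp using Nat.le_induction with
  | base => rw [← blockStart_last, partialSum_rotate_blockStart x c le_rfl]
  | succ p hp ih =>
    rw [partialSum_succ, ih, partialSum_succ, Function.comp_apply, rotate_of_ge c hp]

end Rotation

/-! ### The cycle lemma and the strict minimum. -/

section Counting

/-- Among the cyclic rotations of a sequence summing to zero, exactly one has positive partial
sums, if no proper cyclic partial sum vanishes. -/
theorem existsUnique_rotation_pos {y : ℕ → ℝ} {l : ℕ} (hl : 1 ≤ l)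
    (hy : ∑ r ∈ Finset.range l, y r = 0)
    (hne : ∀ c < l, ∀ q, 0 < q → q < l → ∑ r ∈ Finset.range q, y ((r + c) % l) ≠ 0) :
    ∃! c, c < l ∧ ∀ q, 0 < q → q < l → 0 < ∑ r ∈ Finset.range q, y ((r + c) % l) := by
  -- Since `y` sums to zero, the walk `Y` of its periodic extension is itself periodic. The rotation
  -- by `c` has positive partial sums exactly when `c` is the strict minimum of `Y` over a period.
  set Y : ℕ → ℝ := partialSum fun r => y (r % l) with hY
  have hYadd : ∀ c q, ∑ r ∈ Finset.range q, y ((r + c) % l) = Y (c + q) - Y c := by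
    intro c q
    rw [hY, partialSum, partialSum, Finset.sum_range_add]
    simp [add_comm]
  have hper : ∀ c, Y (c + l) = Y c := by
    intro c
    have := hYadd c l
    rw [sum_range_mod, hy] at this
    linarith
  simp only [hYadd] at hne ⊢
  obtain ⟨c₀, hc₀, hmin⟩ := Finset.exists_min_image (Finset.range l) Y ⟨0, Finset.mem_range.2 hl⟩
  rw [Finset.mem_range] at hc₀
  have h₀ : ∀ q, 0 < q → q < l → 0 < Y (c₀ + q) - Y c₀ := by
    intro q hq0 hql
    refine lt_of_le_of_ne (sub_nonneg.2 ?_) (hne c₀ hc₀ q hq0 hql).symm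
    by_cases h : c₀ + q < l
    · exact hmin _ (Finset.mem_range.2 h)
    · have h1 := hper (c₀ + q - l)
      rw [Nat.sub_add_cancel (by omega)] at h1
      rw [h1]
      exact hmin _ (Finset.mem_range.2 (by omega))
  refine ⟨c₀, ⟨hc₀, h₀⟩, ?_⟩
  -- Of two such starts each would have a level strictly below the other, going once forward and
  -- once around the period.
  · have key : ∀ c c', c < c' → c' < l →
        (∀ q, 0 < q → q < l → 0 < Y (c + q) - Y c) →
        (∀ q, 0 < q → q < l → 0 < Y (c' + q) - Y c') → False := by
      intro c c' hcc hc' h h'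
      have h1 := h (c' - c) (by omega) (by omega)
      have h2 := h' (l - (c' - c)) (by omega) (by omega)
      rw [show c + (c' - c) = c' by omega] at h1
      rw [show c' + (l - (c' - c)) = c + l by omega, hper] at h2
      linarith
    rintro c ⟨hc, h⟩
    by_contra hne'
    rcases lt_or_gt_of_ne hne' with hlt | hlt
    · exact key c c₀ hlt hc₀ h h₀
    · exact key c₀ c hlt hc h₀ h

theorem existsUnique_strict_min {b : ℕ → ℝ} {M : ℕ}
    (hb : ∀ p ≤ M, ∀ q ≤ M, p ≠ q → b p ≠ b q) :
    ∃! i, i ≤ M ∧ ∀ q ≤ M, q ≠ i → b i < b q := by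
  obtain ⟨i, hi, hmin⟩ := Finset.exists_min_image (Finset.range (M + 1)) b ⟨0, by simp⟩
  rw [Finset.mem_range, Nat.lt_succ_iff] at hi
  have hlt : ∀ q ≤ M, q ≠ i → b i < b q := fun q hq hqi =>
    lt_of_le_of_ne (hmin q (Finset.mem_range.2 (Nat.lt_succ_iff.2 hq))) (hb i hi q hq hqi.symm)
  refine ⟨i, ⟨hi, hlt⟩, ?_⟩
  rintro i' ⟨hi', h⟩
  by_contra hne
  exact lt_asymm (h i hi (Ne.symm hne)) (hlt i' hi' hne)

open Classical in
theorem sum_ite_eq_one_of_existsUnique {l : ℕ} {p : ℕ → Prop} (h : ∃! c, c < l ∧ p c) :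
    ∑ c ∈ Finset.range l, (if p c then (1 : ℝ≥0∞) else 0) = 1 := by
  obtain ⟨c, ⟨hc, hpc⟩, huniq⟩ := h
  rw [Finset.sum_eq_single c]
  · simp [hpc]
  · intro c' hc' hne
    rw [if_neg]
    intro hp
    exact hne (huniq c' ⟨Finset.mem_range.1 hc', hp⟩)
  · intro h
    exact absurd (Finset.mem_range.2 hc) h

end Counting

/-! ### Exactly one rearrangement gives a facet on a given side. -/

section Levels

variable {k : ℕ} {j : Fin k → ℕ} {x : ℕ → EuclideanSpace ℝ (Fin (k + 1))}

/-- The sequence whose walk has the blocks of `x` rotated by `c` and started at time `i`. -/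
noncomputable def rearrange {V : Type*} (x : ℕ → V) (j c : Fin k → ℕ) (i : ℕ) : ℕ → V :=
  (x ∘ rotate j c) ∘ gather (∑ m, j m) i

theorem partialSum_rearrange_start (c : Fin k → ℕ) (i : ℕ) :
    partialSum (rearrange x j c i) i =
      partialSum x (∑ m, j m + i) - partialSum x (∑ m, j m) := by
  rw [rearrange, partialSum_gather_of_le le_rfl, partialSum_rotate_of_ge x c le_rfl,
    partialSum_rotate_of_ge x c (by omega)]

theorem partialSum_rearrange_vertexIndex (c : Fin k → ℕ) (i : ℕ) (l : Fin (k + 1)) :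
    partialSum (rearrange x j c i) (vertexIndex j i l) =
      partialSum (rearrange x j c i) i + partialSum x (vertexIndex j 0 l) := by
  rw [partialSum_rearrange_start, vertexIndex, rearrange,
    partialSum_gather_add _ (blockStart_le _), partialSum_rotate_blockStart x c (by omega),
    partialSum_rotate_of_ge x c le_rfl, partialSum_rotate_of_ge x c (by omega), vertexIndex,
    zero_add]

/-- The blocks stay contiguous and in order with unchanged totals, so one normal form serves all
`(c, i)`. -/
theorem edges_rearrange (c : Fin k → ℕ) (i : ℕ) :
    edges (partialSum (rearrange x j c i)) (vertexIndex j i) =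
      edges (partialSum x) (vertexIndex j 0) := by
  funext m
  simp only [edges, partialSum_rearrange_vertexIndex]
  abel

theorem normalForm_partialSum_blockStart {l : ℕ} (hl : l ≤ k) :
    normalForm (edges (partialSum x) (vertexIndex j 0)) (partialSum x (blockStart j l)) = 0 := by
  have h := apply_vertex_eq (w := partialSum x) (a := vertexIndex j 0)
    (fun m => normalForm_edge (e := edges (partialSum x) (vertexIndex j 0)) m)
    ⟨l, Nat.lt_succ_iff.2 hl⟩
  rw [vertexIndex_zero] at h
  simpa [vertexIndex] using h

theorem level_before (c : Fin k → ℕ) {i q : ℕ} (hq : q ≤ i) :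
    partialSum (rearrange x j c i) q - partialSum (rearrange x j c i) i =
      partialSum x (∑ m, j m + q) - partialSum x (∑ m, j m + i) := by
  rw [partialSum_rearrange_start, rearrange, partialSum_gather_of_le hq,
    partialSum_rotate_of_ge x c le_rfl, partialSum_rotate_of_ge x c (by omega)]
  abel

/-- After the blocks the walk is displaced by their total, on which the normal form vanishes. -/
theorem level_after (c : Fin k → ℕ) {i q : ℕ} (hq : i ≤ q) :
    normalForm (edges (partialSum x) (vertexIndex j 0))
      (partialSum (rearrange x j c i) (∑ m, j m + q) - partialSum (rearrange x j c i) i) =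
    normalForm (edges (partialSum x) (vertexIndex j 0))
      (partialSum x (∑ m, j m + q) - partialSum x (∑ m, j m + i)) := by
  have h : partialSum (rearrange x j c i) (∑ m, j m + q) - partialSum (rearrange x j c i) i =
      partialSum x (∑ m, j m + q) - partialSum x (∑ m, j m + i) + partialSum x (∑ m, j m) := by
    rw [partialSum_rearrange_start, rearrange, partialSum_gather_of_ge _ hq,
      partialSum_rotate_of_ge x c (by omega)]
    abel
  rw [h, map_add]
  conv_lhs => rw [← blockStart_last (j := j), normalForm_partialSum_blockStart le_rfl, add_zero]
  rw [blockStart_last]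

theorem level_block (c : Fin k → ℕ) (i : ℕ) (m : Fin k) {q : ℕ} (hq : q < j m) :
    normalForm (edges (partialSum x) (vertexIndex j 0))
      (partialSum (rearrange x j c i) (i + (blockStart j m + q)) -
        partialSum (rearrange x j c i) i) =
    ∑ r ∈ Finset.range q, normalForm (edges (partialSum x) (vertexIndex j 0))
      (x (blockStart j m + (r + c m) % j m)) := by
  have h : partialSum (rearrange x j c i) (i + (blockStart j m + q)) -
        partialSum (rearrange x j c i) i =
      partialSum x (blockStart j m) +
        ∑ r ∈ Finset.range q, x (blockStart j m + (r + c m) % j m) := by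
    rw [partialSum_rearrange_start, rearrange, partialSum_gather_add _ (block_lt m hq).le,
      partialSum_rotate_add x c m hq.le, partialSum_rotate_blockStart x c m.2.le,
      partialSum_rotate_of_ge x c le_rfl, partialSum_rotate_of_ge x c (by omega)]
    abel
  rw [h, map_add, normalForm_partialSum_blockStart m.2.le, zero_add, map_sum]

theorem notMem_range_vertexIndex_of_lt {i p : ℕ} (hp : p < i) :
    p ∉ Set.range (vertexIndex j i) := by
  rintro ⟨l, rfl⟩
  simp [vertexIndex] at hp

theorem notMem_range_vertexIndex_of_gt {i q : ℕ} (hq : i < q) :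
    ∑ m, j m + q ∉ Set.range (vertexIndex j i) := by
  rintro ⟨l, hl⟩
  have := vertexIndex_le (j := j) i l
  omega

theorem notMem_range_vertexIndex_block (i : ℕ) (m : Fin k) {q : ℕ} (hq0 : 0 < q) (hq : q < j m) :
    i + (blockStart j m + q) ∉ Set.range (vertexIndex j i) := by
  rintro ⟨l, hl⟩
  have h1 := blockStart_succ (j := j) m
  rw [vertexIndex] at hl
  rcases le_or_gt (l : ℕ) m with h | h
  · have := blockStart_mono (j := j) h
    omega
  · have := blockStart_mono (j := j) (show (m : ℕ) + 1 ≤ l from h)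
    omega

/-- Outside the blocks the levels involve only `i`, inside block `m` only `c m`. The facet condition
therefore splits into independent conditions on `i` and on each `c m`, which can be counted
separately. -/
theorem liesAbove_rearrange_iff (s : ℝ) {M : ℕ} (c : Fin k → ℕ) {i : ℕ} (hi : i ≤ M) :
    LiesAbove s (partialSum (rearrange x j c i)) (∑ m, j m + M) (vertexIndex j i) ↔
      (∀ q ≤ M, q ≠ i →
        s * normalForm (edges (partialSum x) (vertexIndex j 0)) (partialSum x (∑ m, j m + i)) <
        s * normalForm (edges (partialSum x) (vertexIndex j 0)) (partialSum x (∑ m, j m + q))) ∧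
      ∀ m, ∀ q, 0 < q → q < j m → 0 < ∑ r ∈ Finset.range q,
        s * normalForm (edges (partialSum x) (vertexIndex j 0))
          (x (blockStart j m + (r + c m) % j m)) := by
  rw [LiesAbove, edges_rearrange, vertexIndex_zero]
  constructor
  · intro h
    refine ⟨fun q hq hqi => ?_, fun m q hq0 hq => ?_⟩
    · rcases lt_or_gt_of_ne hqi with hlt | hlt
      · have h1 := h q (by omega) (notMem_range_vertexIndex_of_lt hlt)
        rw [level_before c hlt.le, map_sub] at h1
        linarith
      · have h1 := h (∑ m, j m + q) (by omega) (notMem_range_vertexIndex_of_gt hlt)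
        rw [level_after c hlt.le, map_sub] at h1
        linarith
    · have h2 := block_lt m hq
      have h1 := h (i + (blockStart j m + q)) (by omega) (notMem_range_vertexIndex_block i m hq0 hq)
      rwa [level_block c i m hq, Finset.mul_sum] at h1
  · rintro ⟨hends, hblocks⟩ p hp hpa
    rcases lt_or_ge p i with hlt | hge
    · rw [level_before c hlt.le, map_sub]
      have := hends p (by omega) hlt.ne
      linarith
    · rcases lt_or_ge p (i + ∑ m, j m) with hlt | hge'
      · obtain ⟨m, q, hq, hpq⟩ := exists_block (j := j) (p := p - i) (by omega)
        obtain rfl : p = i + (blockStart j m + q) := by omega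
        have hq0 : 0 < q := by
          rcases Nat.eq_zero_or_pos q with rfl | h
          · exact absurd ⟨m.castSucc, rfl⟩ hpa
          · exact h
        rw [level_block c i m hq, Finset.mul_sum]
        exact hblocks m q hq0 hq
      · obtain ⟨q, rfl⟩ : ∃ q, p = ∑ m, j m + q := ⟨p - ∑ m, j m, by omega⟩
        have hqi : q ≠ i := by
          rintro rfl
          refine hpa ⟨Fin.last k, ?_⟩
          rw [vertexIndex, Fin.val_last, blockStart_last, add_comm]
        rw [level_after c (by omega), map_sub]
        have := hends q (by omega) hqi
        linarith

open Classical in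
/-- Exactly one of the rearrangements puts the marked points on a facet with the rest of the walk
on a prescribed side. -/
theorem sum_liesAbove_rearrange {s : ℝ} (hs : s ≠ 0) {M : ℕ} (hj : ∀ m, 1 ≤ j m)
    (hx : ∀ c : Fin k → ℕ, ∀ i,
      InGeneralPosition k (partialSum (rearrange x j c i)) (∑ m, j m + M)) :
    ∑ c ∈ Fintype.piFinset fun m => Finset.range (j m), ∑ i ∈ Finset.range (M + 1),
      (if LiesAbove s (partialSum (rearrange x j c i)) (∑ m, j m + M) (vertexIndex j i)
        then (1 : ℝ≥0∞) else 0) = 1 := by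
  set ν := normalForm (edges (partialSum x) (vertexIndex j 0)) with hν
  have hne : ∀ c : Fin k → ℕ, ∀ i ≤ M, ∀ p ≤ ∑ m, j m + M, p ∉ Set.range (vertexIndex j i) →
      ν (partialSum (rearrange x j c i) p - partialSum (rearrange x j c i) i) ≠ 0 := by
    intro c i hi p hp hpa
    have := (hx c i).normalForm_ne_zero (vertexIndex_strictMono hj i)
      (fun l => (vertexIndex_le i l).trans (by omega)) hp hpa
    rwa [edges_rearrange, vertexIndex_zero] at this
  have hends : ∀ p ≤ M, ∀ q ≤ M, p ≠ q →
      s * ν (partialSum x (∑ m, j m + p)) ≠ s * ν (partialSum x (∑ m, j m + q)) := by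
    have key : ∀ p q, p < q → q ≤ M →
        s * ν (partialSum x (∑ m, j m + p)) ≠ s * ν (partialSum x (∑ m, j m + q)) := by
      intro p q hlt hq h
      -- A tie between `p < q` would put the unmarked point `p` on the facet hyperplane of the
      -- rearrangement started at `q`; any rotation would do here.
      have h1 := hne 0 q hq p (by omega) (notMem_range_vertexIndex_of_lt hlt)
      rw [level_before 0 hlt.le, map_sub] at h1
      exact h1 (sub_eq_zero.2 (mul_left_cancel₀ hs h))
    intro p hp q hq hpq
    rcases lt_or_gt_of_ne hpq with h | h
    · exact key p q h hq
    · exact (key q p h hp).symm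
  have hblock : ∀ m : Fin k, ∑ c ∈ Finset.range (j m),
      (if ∀ q, 0 < q → q < j m → 0 < ∑ r ∈ Finset.range q,
        s * ν (x (blockStart j m + (r + c) % j m)) then (1 : ℝ≥0∞) else 0) = 1 := by
    intro m
    refine sum_ite_eq_one_of_existsUnique (existsUnique_rotation_pos
      (y := fun r => s * ν (x (blockStart j m + r))) (hj m) ?_ ?_)
    -- The level vanishes at both ends of the block, so its increments sum to zero.
    · rw [← Finset.mul_sum, ← map_sum]
      have h1 := normalForm_partialSum_blockStart (j := j) (x := x) (l := m + 1) m.2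
      have h2 := normalForm_partialSum_blockStart (j := j) (x := x) (l := m) m.2.le
      rw [blockStart_succ, partialSum, Finset.sum_range_add, map_add] at h1
      rw [partialSum] at h2
      rw [h2, zero_add] at h1
      rw [hν, h1, mul_zero]
    · intro c hc q hq0 hq
      rw [← Finset.mul_sum]
      -- A vanishing cyclic partial sum would put an unmarked point on the hyperplane for the
      -- rearrangement rotating every block by `c`.
      refine mul_ne_zero hs ?_
      have h1 := hne (fun _ => c) 0 (Nat.zero_le M) (0 + (blockStart j m + q))
        (by have := block_lt m hq; omega) (notMem_range_vertexIndex_block 0 m hq0 hq)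
      rwa [hν, level_block (fun _ => c) 0 m hq] at h1
  have hend : ∑ i ∈ Finset.range (M + 1), (if ∀ q ≤ M, q ≠ i →
      s * ν (partialSum x (∑ m, j m + i)) < s * ν (partialSum x (∑ m, j m + q))
        then (1 : ℝ≥0∞) else 0) = 1 := by
    convert! sum_ite_eq_one_of_existsUnique (l := M + 1)
      (by simpa only [Nat.lt_succ_iff] using existsUnique_strict_min hends)
  have hsplit : ∀ c : Fin k → ℕ, ∀ i ∈ Finset.range (M + 1),
      (if LiesAbove s (partialSum (rearrange x j c i)) (∑ m, j m + M) (vertexIndex j i)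
        then (1 : ℝ≥0∞) else 0) =
      (∏ m, if ∀ q, 0 < q → q < j m → 0 < ∑ r ∈ Finset.range q,
        s * ν (x (blockStart j m + (r + c m) % j m)) then (1 : ℝ≥0∞) else 0) *
      if ∀ q ≤ M, q ≠ i → s * ν (partialSum x (∑ m, j m + i)) < s * ν (partialSum x (∑ m, j m + q))
        then 1 else 0 := by
    intro c i hi
    rw [Finset.prod_ite_zero, Finset.prod_const_one]
    simp only [liesAbove_rearrange_iff s c (Nat.lt_succ_iff.1 (Finset.mem_range.1 hi)),
      Finset.mem_univ, true_imp_iff]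
    rw [ite_and, ite_mul, zero_mul, one_mul]
    split_ifs <;> rfl
  calc _ = ∑ c ∈ Fintype.piFinset fun m => Finset.range (j m),
        ∏ m, (if ∀ q, 0 < q → q < j m → 0 < ∑ r ∈ Finset.range q,
          s * ν (x (blockStart j m + (r + c m) % j m)) then (1 : ℝ≥0∞) else 0) := by
        refine Finset.sum_congr rfl fun c _ => ?_
        rw [Finset.sum_congr rfl (hsplit c), ← Finset.mul_sum, hend, mul_one]
    _ = ∏ m, ∑ c ∈ Finset.range (j m), (if ∀ q, 0 < q → q < j m → 0 < ∑ r ∈ Finset.range q,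
          s * ν (x (blockStart j m + (r + c) % j m)) then (1 : ℝ≥0∞) else 0) := by
        rw [Finset.prod_univ_sum]
    _ = 1 := by simp [hblock]

end Levels

/-! ### Independence of block sums and invariance of the law. -/

section Independence

variable {Ω : Type*} [MeasurableSpace Ω] {P : Measure Ω}

/-- Both joint laws are infinite products, and currying carries a product over pairs to a product of
products. -/
theorem iIndepFun_curry {ι : Type*} {κ : ι → Type*} {β : Type*} [MeasurableSpace β]
    {X : (i : ι) → κ i → Ω → β} (mX : ∀ i j, Measurable (X i j))
    (h : iIndepFun (fun (p : (i : ι) × κ i) ω => X p.1 p.2 ω) P) :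
    iIndepFun (fun i ω j => X i j ω) P := by
  have := h.isProbabilityMeasure
  have : ∀ i j, IsProbabilityMeasure (P.map (X i j)) :=
    fun i j => Measure.isProbabilityMeasure_map (mX i j).aemeasurable
  have h2 : ∀ i, iIndepFun (X i) P := fun i =>
    h.precomp (g := fun j : κ i => (⟨i, j⟩ : (i : ι) × κ i)) sigma_mk_injective
  have h3 : (MeasurableEquiv.piCurry fun (i : ι) (_ : κ i) => β) ∘ (fun ω p => X p.1 p.2 ω) =
      fun ω i j => X i j ω := by
    ext; simp [Sigma.curry]
  rw [iIndepFun_iff_map_fun_eq_infinitePi_map (by fun_prop), ← h3,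
    ← Measure.map_map (by fun_prop) (by fun_prop),
    (iIndepFun_iff_map_fun_eq_infinitePi_map (by fun_prop)).1 h,
    Measure.infinitePi_map_piCurry (fun i j => P.map (X i j))]
  congrm Measure.infinitePi fun i => ?_
  rw [(iIndepFun_iff_map_fun_eq_infinitePi_map (by fun_prop)).1 (h2 i)]

variable {V : Type*} [AddCommMonoid V] [MeasurableSpace V] [MeasurableAdd₂ V]

theorem iIndepFun_sum_of_disjoint {α ι : Type*} {X : α → Ω → V} (mX : ∀ i, Measurable (X i))
    (h : iIndepFun X P) {S : ι → Finset α} (hS : ∀ i j, i ≠ j → Disjoint (S i) (S j)) :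
    iIndepFun (fun i ω => ∑ p ∈ S i, X p ω) P := by
  have hinj : Function.Injective fun p : (i : ι) × S i => (p.2 : α) := by
    rintro ⟨i, p, hp⟩ ⟨i', p', hp'⟩ heq
    obtain rfl : p = p' := heq
    obtain rfl : i = i' := by
      by_contra hne
      exact Finset.disjoint_left.1 (hS _ _ hne) hp hp'
    rfl
  have h1 := iIndepFun_curry (X := fun i (p : S i) => X p) (fun i p => mX p) (h.precomp hinj)
  have h2 := h1.comp (fun i (f : S i → V) => ∑ p, f p) fun i => by fun_prop
  convert h2 using 2 with i
  funext ω
  exact (Finset.sum_coe_sort (S i) fun p => X p ω).symm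

theorem iIndepFun_edges {V : Type*} [AddCommGroup V] [MeasurableSpace V] [MeasurableAdd₂ V]
    {X : ℕ → Ω → V} (mX : ∀ i, Measurable (X i)) (h : iIndepFun X P) {r : ℕ}
    {a : Fin (r + 1) → ℕ} (ha : Monotone a) :
    iIndepFun (fun m ω => edges (partialSum fun i => X i ω) a m) P := by
  have h1 := iIndepFun_sum_of_disjoint mX h
    (S := fun m : Fin r => Finset.Ico (a m.castSucc) (a m.succ)) (by
      intro m m' hne
      rw [Finset.disjoint_left]
      intro p hp hp'
      rw [Finset.mem_Ico] at hp hp'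
      rcases lt_or_gt_of_ne hne with hlt | hlt
      · have := ha (show m.succ ≤ m'.castSucc from hlt)
        omega
      · have := ha (show m'.succ ≤ m.castSucc from hlt)
        omega)
  convert h1 using 2 with m
  funext ω
  exact edges_partialSum _ ha m

/-- The law of an i.i.d. sequence is invariant under injective reindexing. -/
theorem identDistrib_comp_injective {β : Type*} [MeasurableSpace β] {X : ℕ → Ω → β}
    (mX : ∀ i, Measurable (X i)) (h : iIndepFun X P) (hX : ∀ i, IdentDistrib (X i) (X 0) P P)
    {σ : ℕ → ℕ} (hσ : Function.Injective σ) :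
    IdentDistrib (fun ω i => X (σ i) ω) (fun ω i => X i ω) P P := by
  refine ⟨(by fun_prop), (by fun_prop), ?_⟩
  have := h.isProbabilityMeasure
  rw [(h.precomp hσ).map_fun_eq_infinitePi_map (fun i => mX _), h.map_fun_eq_infinitePi_map mX]
  congrm Measure.infinitePi fun i => ?_
  exact (hX (σ i)).map_eq.trans (hX i).map_eq.symm

end Independence

/-! ### Almost sure general position. -/

section GeneralPosition

variable {Ω : Type*} [MeasurableSpace Ω] {P : Measure Ω} {d : ℕ}

theorem chargesNoHyperplane_congr {Y Z : Ω → EuclideanSpace ℝ (Fin d)}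
    (h : IdentDistrib Y Z P P) (hZ : ChargesNoHyperplane Z P) : ChargesNoHyperplane Y P := by
  intro u c hu
  rw [← hZ u c hu]
  exact h.measure_mem_eq
    (isClosed_eq (f := fun x => inner ℝ u x) (by fun_prop) continuous_const).measurableSet

/-- Given the value of `Y`, the event asks `Z` to lie on a translated hyperplane. -/
theorem chargesNoHyperplane_add {Y Z : Ω → EuclideanSpace ℝ (Fin d)} [IsProbabilityMeasure P]
    (hY : Measurable Y) (hZ : Measurable Z) (h : IndepFun Y Z P) (hZP : ChargesNoHyperplane Z P) :
    ChargesNoHyperplane (fun ω => Y ω + Z ω) P := by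
  intro u c hu
  have hS : MeasurableSet {p : EuclideanSpace ℝ (Fin d) × EuclideanSpace ℝ (Fin d) |
      inner ℝ u (p.1 + p.2) = c} :=
    (isClosed_eq (by fun_prop) continuous_const).measurableSet
  have h1 : {ω | inner ℝ u (Y ω + Z ω) = c} = (fun ω => (Y ω, Z ω)) ⁻¹'
      {p | inner ℝ u (p.1 + p.2) = c} := rfl
  rw [h1, ← Measure.map_apply (by fun_prop) hS,
    (indepFun_iff_map_prod_eq_prod_map_map hY.aemeasurable hZ.aemeasurable).1 h,
    Measure.measure_prod_null hS]
  refine Filter.Eventually.of_forall fun y => ?_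
  have hS' : MeasurableSet (Prod.mk y ⁻¹' {p : EuclideanSpace ℝ (Fin d) × EuclideanSpace ℝ (Fin d) |
      inner ℝ u (p.1 + p.2) = c}) := measurable_prodMk_left hS
  change P.map Z _ = 0
  rw [Measure.map_apply hZ hS']
  convert hZP u (c - inner ℝ u y) hu using 2
  ext ω
  simp only [Set.mem_preimage, Set.mem_ofPred_eq, inner_add_right]
  constructor <;> intro h <;> linarith

theorem chargesNoHyperplane_sum [IsProbabilityMeasure P] {X : ℕ → Ω → EuclideanSpace ℝ (Fin d)}
    (mX : ∀ i, Measurable (X i)) (h : iIndepFun X P) (hX : ∀ i, ChargesNoHyperplane (X i) P)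
    {s : Finset ℕ} (hs : s.Nonempty) : ChargesNoHyperplane (fun ω => ∑ i ∈ s, X i ω) P := by
  obtain ⟨i, hi⟩ := hs
  have h1 := h.indepFun_finsetSum_of_notMem mX (Finset.notMem_erase i s)
  have h2 := chargesNoHyperplane_add (by fun_prop) (mX i) h1 (hX i)
  convert h2 using 2 with ω
  rw [Finset.sum_apply, Finset.sum_erase_add _ _ hi]

theorem measurableSet_linearIndependent {V : Type*} [NormedAddCommGroup V] [InnerProductSpace ℝ V]
    [MeasurableSpace V] [BorelSpace V] [SecondCountableTopology V] (r : ℕ) :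
    MeasurableSet {v : Fin r → V | LinearIndependent ℝ v} := by
  simp_rw [← Matrix.det_gram_ne_zero_iff_linearIndependent (𝕜 := ℝ)]
  refine IsOpen.measurableSet (isOpen_ne_fun ?_ continuous_const)
  refine Continuous.matrix_det (continuous_matrix fun i j => ?_)
  simp only [Matrix.gram_apply]
  fun_prop

/-- Induction on the number of vectors: the tail spans a proper subspace, which lies in a hyperplane
through the origin that the head almost surely misses. -/
theorem ae_linearIndependent_pi {r : ℕ} (hr : r ≤ d)
    (μ : Fin r → Measure (EuclideanSpace ℝ (Fin d))) [∀ i, IsProbabilityMeasure (μ i)]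
    (hμ : ∀ i u, u ≠ 0 → μ i {x | inner ℝ u x = 0} = 0) :
    ∀ᵐ v ∂Measure.pi μ, LinearIndependent ℝ v := by
  induction r with
  | zero => exact Filter.Eventually.of_forall fun v => linearIndependent_empty_type
  | succ r ih =>
    have hmp := measurePreserving_piFinSuccAbove μ 0
    have hset := (MeasurableEquiv.piFinSuccAbove
      (fun _ : Fin (r + 1) => EuclideanSpace ℝ (Fin d)) 0).symm.measurable
        (measurableSet_linearIndependent (V := EuclideanSpace ℝ (Fin d)) (r + 1))
    have h1 : ∀ᵐ p ∂(μ 0).prod (Measure.pi fun j => μ ((0 : Fin (r + 1)).succAbove j)),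
        LinearIndependent ℝ (Fin.cons p.1 p.2 : Fin (r + 1) → EuclideanSpace ℝ (Fin d)) := by
      have hset' : MeasurableSet
          {p : EuclideanSpace ℝ (Fin d) × (Fin r → EuclideanSpace ℝ (Fin d)) |
          LinearIndependent ℝ (Fin.cons p.1 p.2 : Fin (r + 1) → EuclideanSpace ℝ (Fin d))} := by
        convert hset using 1
        ext p
        simp only [MeasurableEquiv.piFinSuccAbove, MeasurableEquiv.symm_mk, MeasurableEquiv.coe_mk,
          Fin.insertNthEquiv_zero]
        rfl
      -- The order of integration is swapped so that the tail is fixed before the head.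
      refine (Measure.ae_prod_iff_ae_ae hset').2 ((Measure.ae_ae_comm hset').2 ?_)
      filter_upwards [ih (by omega) (fun j => μ ((0 : Fin (r + 1)).succAbove j)) fun j => hμ _]
        with v hv
      have hlt : Submodule.span ℝ (Set.range v) < ⊤ := by
        refine lt_top_iff_ne_top.2 fun htop => ?_
        have h1 := finrank_span_eq_card hv
        rw [htop, finrank_top, finrank_euclideanSpace_fin, Fintype.card_fin] at h1
        omega
      obtain ⟨u, hu, hu0⟩ := Submodule.exists_mem_ne_zero_of_ne_bot
        (mt (Submodule.orthogonal_eq_bot_iff).1 hlt.ne)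
      have h3 := hμ 0 u hu0
      rw [← compl_mem_ae_iff] at h3
      filter_upwards [h3] with x hx
      refine linearIndependent_finCons.2 ⟨hv, fun hmem => hx ?_⟩
      exact (Submodule.mem_orthogonal' _ u).1 hu x hmem
    have h2 := hmp.quasiMeasurePreserving.ae h1
    filter_upwards [h2] with v hv
    convert hv using 1
    funext i
    refine Fin.cases ?_ (fun i => ?_) i <;> rfl

theorem ae_inGeneralPosition [IsProbabilityMeasure P] {k : ℕ}
    {X : ℕ → Ω → EuclideanSpace ℝ (Fin (k + 1))} (mX : ∀ i, Measurable (X i))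
    (h : iIndepFun X P) (hX : ∀ i, ChargesNoHyperplane (X i) P) (n : ℕ) :
    ∀ᵐ ω ∂P, InGeneralPosition k (partialSum fun i => X i ω) n := by
  have hall : ∀ᵐ ω ∂P, ∀ a : Fin (k + 2) → ℕ, StrictMono a →
      LinearIndependent ℝ (edges (partialSum fun i => X i ω) a) := by
    rw [ae_all_iff]
    intro a
    by_cases ha : StrictMono a
    · have hind := iIndepFun_edges mX h ha.monotone
      have hmeas : ∀ m : Fin (k + 1), Measurable fun ω =>
          edges (partialSum fun i => X i ω) a m := by
        intro m
        simp only [edges_partialSum _ ha.monotone]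
        fun_prop
      have hlaw := (iIndepFun_iff_map_fun_eq_pi_map fun m => (hmeas m).aemeasurable).1 hind
      have : ∀ m : Fin (k + 1), IsProbabilityMeasure
          (P.map fun ω => edges (partialSum fun i => X i ω) a m) :=
        fun m => Measure.isProbabilityMeasure_map (hmeas m).aemeasurable
      have h1 := ae_linearIndependent_pi le_rfl
        (fun m : Fin (k + 1) => P.map fun ω => edges (partialSum fun i => X i ω) a m) (by
          intro m u hu
          rw [Measure.map_apply (hmeas m)
            (isClosed_eq (by fun_prop) continuous_const).measurableSet]
          have := chargesNoHyperplane_sum mX h hX (s := Finset.Ico (a m.castSucc) (a m.succ))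
            (Finset.nonempty_Ico.2 (ha Fin.castSucc_lt_succ)) u 0 hu
          simp only [edges_partialSum _ ha.monotone]
          exact this)
      rw [← hlaw] at h1
      have h2 := ae_of_ae_map (measurable_pi_iff.2 hmeas).aemeasurable h1
      filter_upwards [h2] with ω hω _ using hω
    · exact Filter.Eventually.of_forall fun ω h => absurd h ha
  filter_upwards [hall] with ω hω a ha _ using hω a ha

end GeneralPosition

/-! ### Facet volumes as measurable functionals of the steps. -/

/-- The volume of the parallelepiped spanned by `e`. -/
noncomputable def gramVolume {V : Type*} [NormedAddCommGroup V] [InnerProductSpace ℝ V] {k : ℕ}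
    (e : Fin k → V) : ℝ≥0∞ :=
  ENNReal.ofReal √(Matrix.gram ℝ e).det

open Classical in
/-- The volume spanned by the marked points of a walk if all its other points lie on the prescribed
side of the hyperplane through them, and zero otherwise. -/
noncomputable def facetVolume {k : ℕ} (s : ℝ) (n : ℕ) (j : Fin k → ℕ) (i : ℕ)
    (x : ℕ → EuclideanSpace ℝ (Fin (k + 1))) : ℝ≥0∞ :=
  if LiesAbove s (partialSum x) n (vertexIndex j i) then
    gramVolume (edges (partialSum x) (vertexIndex j i)) else 0

section Measurability

variable {k : ℕ}

theorem continuous_edges_partialSum {V : Type*} [AddCommGroup V] [TopologicalSpace V]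
    [IsTopologicalAddGroup V] {r : ℕ} (a : Fin (r + 1) → ℕ) :
    Continuous fun x : ℕ → V => edges (partialSum x) a := by
  refine continuous_pi fun m => ?_
  unfold edges partialSum
  fun_prop

theorem measurable_gramVolume {V : Type*} [NormedAddCommGroup V] [InnerProductSpace ℝ V]
    [MeasurableSpace V] [BorelSpace V] [SecondCountableTopology V] :
    Measurable fun e : Fin k → V => gramVolume e := by
  refine ENNReal.measurable_ofReal.comp (Continuous.measurable ?_)
  refine Real.continuous_sqrt.comp (Continuous.matrix_det (continuous_matrix fun i j => ?_))
  simp only [Matrix.gram_apply]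
  fun_prop

theorem measurableSet_liesAbove (s : ℝ) (n : ℕ) (a : Fin (k + 1) → ℕ) :
    MeasurableSet {x : ℕ → EuclideanSpace ℝ (Fin (k + 1)) | LiesAbove s (partialSum x) n a} := by
  have h : {x : ℕ → EuclideanSpace ℝ (Fin (k + 1)) | LiesAbove s (partialSum x) n a} =
      ⋂ (p : ℕ) (_ : p ≤ n) (_ : p ∉ Set.range a),
        {x | 0 < s * normalForm (edges (partialSum x) a) (partialSum x p - partialSum x (a 0))} := by
    ext x
    simp [LiesAbove]
  rw [h]
  refine MeasurableSet.iInter fun p => MeasurableSet.iInter fun _ =>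
    MeasurableSet.iInter fun _ => ?_
  refine (isOpen_lt continuous_const (continuous_const.mul ?_)).measurableSet
  simp only [normalForm_apply]
  refine Continuous.matrix_det (continuous_matrix fun i l => ?_)
  refine Fin.cases ?_ (fun i => ?_) i
  · simp only [Matrix.of_apply, Matrix.cons_val_zero, partialSum]
    fun_prop
  · simp only [Matrix.of_apply, Matrix.cons_val_succ]
    have := (continuous_apply i).comp
      (continuous_edges_partialSum (V := EuclideanSpace ℝ (Fin (k + 1))) a)
    exact (EuclideanSpace.proj (𝕜 := ℝ) l).continuous.comp this

theorem measurable_facetVolume (s : ℝ) (n : ℕ) (j : Fin k → ℕ) (i : ℕ) :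
    Measurable (facetVolume s n j i) := by
  exact Measurable.ite (measurableSet_liesAbove s n (vertexIndex j i))
    (measurable_gramVolume.comp
      (continuous_edges_partialSum (V := EuclideanSpace ℝ (Fin (k + 1)))
        (vertexIndex j i)).measurable)
    measurable_const

end Measurability

theorem InGeneralPosition.measure_frontier_partialSum {k n : ℕ} (hn : k + 1 ≤ n)
    {x : ℕ → EuclideanSpace ℝ (Fin (k + 1))} (hx : InGeneralPosition k (partialSum x) n) :
    μHE[k] (frontier (convexHull ℝ (partialSum x '' Set.Iic n))) =
      ∑ j ∈ stepTuples k n, ∑ i ∈ Finset.range (n - ∑ m, j m + 1),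
        (facetVolume 1 n j i x + facetVolume (-1) n j i x) / (k ! : ℝ≥0∞) := by
  classical
  rw [hx.measure_frontier (by simp) hn, sum_powersetCard_eq]
  refine Finset.sum_congr rfl fun j hj => Finset.sum_congr rfl fun i hi => ?_
  rw [mem_stepTuples] at hj
  rw [Finset.mem_range] at hi
  have ha := vertexIndex_strictMono hj.1 i
  have han : ∀ l, vertexIndex j i l ≤ n := fun l => (vertexIndex_le i l).trans (by omega)
  have himg : partialSum x '' ((Finset.univ.image (vertexIndex j i) : Finset ℕ) : Set ℕ) =
      Set.range fun l => partialSum x (vertexIndex j i l) := by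
    rw [Finset.coe_image, Finset.coe_univ, Set.image_univ, ← Set.range_comp]
    rfl
  rw [himg, euclideanHausdorffMeasure_convexHull_range]
  simp only [hx.isFacet_iff hn ha han]
  have hnot := not_liesAbove_both (w := partialSum x) (a := vertexIndex j i) hn
  unfold facetVolume gramVolume edges
  by_cases h1 : LiesAbove 1 (partialSum x) n (vertexIndex j i)
  · simp [h1, hnot h1]
  · by_cases h2 : LiesAbove (-1) (partialSum x) n (vertexIndex j i)
    · simp [h1, h2]
    · simp [h1, h2]

/-! ### Expected facet volumes. -/

section Expectation

variable {Ω : Type*} [MeasurableSpace Ω] {P : Measure Ω} [IsProbabilityMeasure P] {k : ℕ}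
  {X : ℕ → Ω → EuclideanSpace ℝ (Fin (k + 1))}

/-- Average over all rotations: each rearrangement leaves the expectation unchanged, and pointwise
exactly one pair `(c, i)` contributes, always with the same Gram volume. -/
theorem lintegral_sum_facetVolume (mX : ∀ i, Measurable (X i)) (h : iIndepFun X P)
    (hident : ∀ i, IdentDistrib (X i) (X 0) P P) (hX : ChargesNoHyperplane (X 0) P)
    {s : ℝ} (hs : s ≠ 0) {n : ℕ} {j : Fin k → ℕ} (hj : j ∈ stepTuples k n) :
    ∑ i ∈ Finset.range (n - ∑ m, j m + 1), ∫⁻ ω, facetVolume s n j i (fun i => X i ω) ∂P =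
      (∫⁻ ω, gramVolume (edges (partialSum fun i => X i ω) (vertexIndex j 0)) ∂P) /
        ∏ m, (j m : ℝ≥0∞) := by
  classical
  rw [mem_stepTuples] at hj
  obtain ⟨M, rfl⟩ := Nat.exists_eq_add_of_le hj.2
  rw [Nat.add_sub_cancel_left]
  have hX' : ∀ i, ChargesNoHyperplane (X i) P := fun i => chargesNoHyperplane_congr (hident i) hX
  have hinj : ∀ (c : Fin k → ℕ) (i : ℕ),
      Function.Injective (rotate j c ∘ gather (∑ m, j m) i) := fun c i =>
    (rotate_injective c).comp (gather_injective _ _)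
  -- There are countably many pairs `(c, i)`, so general position holds for all rearrangements
  -- simultaneously.
  have hgp : ∀ᵐ ω ∂P, ∀ (c : Fin k → ℕ) (i : ℕ),
      InGeneralPosition k (partialSum (rearrange (fun i => X i ω) j c i)) (∑ m, j m + M) := by
    simp only [ae_all_iff]
    intro c i
    exact ae_inGeneralPosition (X := fun p => X (rotate j c (gather (∑ m, j m) i p)))
      (fun p => mX _) (h.precomp (hinj c i)) (fun p => hX' _) _
  have hexch : ∀ (c : Fin k → ℕ) (i : ℕ),
      ∫⁻ ω, facetVolume s (∑ m, j m + M) j i (fun i => X i ω) ∂P =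
        ∫⁻ ω, facetVolume s (∑ m, j m + M) j i (rearrange (fun i => X i ω) j c i) ∂P := fun c i =>
    ((identDistrib_comp_injective mX h hident (hinj c i)).comp
      (measurable_facetVolume s (∑ m, j m + M) j i)).lintegral_eq.symm
  have hmX : Measurable fun ω i => X i ω := measurable_pi_iff.2 mX
  have hmeas : ∀ (c : Fin k → ℕ) (i : ℕ), Measurable fun ω =>
      facetVolume s (∑ m, j m + M) j i (rearrange (fun i => X i ω) j c i) := fun c i =>
    (measurable_facetVolume _ _ _ _).comp (measurable_pi_iff.2 fun p => mX _)
  have hcard : ((Fintype.piFinset fun m => Finset.range (j m)).card : ℝ≥0∞) =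
      ∏ m, (j m : ℝ≥0∞) := by
    simp [Fintype.card_piFinset]
  have hne0 : ∏ m, (j m : ℝ≥0∞) ≠ 0 := by
    rw [Finset.prod_ne_zero_iff]
    intro m _
    have := hj.1 m
    exact_mod_cast (by omega : j m ≠ 0)
  have hnetop : ∏ m, (j m : ℝ≥0∞) ≠ ∞ := by
    rw [← hcard]
    exact ENNReal.natCast_ne_top _
  -- The product of the `j m` is the number of rotation vectors `c`, so multiplying by it becomes a
  -- sum over `c`.
  rw [ENNReal.eq_div_iff hne0 hnetop, ← hcard, ← nsmul_eq_mul, ← Finset.sum_const]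
  calc _ = ∑ c ∈ Fintype.piFinset fun m => Finset.range (j m), ∑ i ∈ Finset.range (M + 1),
        ∫⁻ ω, facetVolume s (∑ m, j m + M) j i (rearrange (fun i => X i ω) j c i) ∂P :=
        Finset.sum_congr rfl fun c _ => Finset.sum_congr rfl fun i _ => hexch c i
    _ = ∫⁻ ω, ∑ c ∈ Fintype.piFinset fun m => Finset.range (j m), ∑ i ∈ Finset.range (M + 1),
        facetVolume s (∑ m, j m + M) j i (rearrange (fun i => X i ω) j c i) ∂P := by
        rw [lintegral_finsetSum _ fun c _ => Finset.measurable_fun_sum _ fun i _ => hmeas c i]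
        refine Finset.sum_congr rfl fun c _ => ?_
        rw [lintegral_finsetSum _ fun i _ => hmeas c i]
    _ = _ := by
        refine lintegral_congr_ae ?_
        filter_upwards [hgp] with ω hω
        have h1 := sum_liesAbove_rearrange hs hj.1 hω
        have h2 : ∀ (c : Fin k → ℕ) (i : ℕ),
            facetVolume s (∑ m, j m + M) j i (rearrange (fun i => X i ω) j c i) =
            (if LiesAbove s (partialSum (rearrange (fun i => X i ω) j c i)) (∑ m, j m + M)
              (vertexIndex j i) then (1 : ℝ≥0∞) else 0) *
              gramVolume (edges (partialSum fun i => X i ω) (vertexIndex j 0)) := by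
          intro c i
          rw [facetVolume, edges_rearrange, ite_mul, one_mul, zero_mul]
        simp only [h2, ← Finset.sum_mul]
        rw [h1, one_mul]

/-- The edges are independent and the `m`-th is a sum of `j m` steps, so their joint law is that of
the copies at times `j m`. -/
theorem lintegral_gramVolume_edges {Ω' : Type*} [MeasurableSpace Ω'] {P' : Measure Ω'}
    [IsProbabilityMeasure P'] (mX : ∀ i, Measurable (X i)) (h : iIndepFun X P)
    (hident : ∀ i, IdentDistrib (X i) (X 0) P P)
    {S : Fin k → ℕ → Ω' → EuclideanSpace ℝ (Fin (k + 1))}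
    (hcopy : ∀ m, IdentDistrib (fun ω' p => S m p ω') (fun ω p => walk X p ω) P' P)
    (hcopies : iIndepFun (fun m ω' p => S m p ω') P') (j : Fin k → ℕ) :
    ∫⁻ ω, gramVolume (edges (partialSum fun i => X i ω) (vertexIndex j 0)) ∂P =
      ∫⁻ ω', gramVolume (fun m => S m (j m) ω') ∂P' := by
  have hmono : Monotone (vertexIndex j 0) := Fin.monotone_iff_le_succ.2 fun m => by
    rw [vertexIndex_succ]
    omega
  have hmE : ∀ m : Fin k, Measurable fun ω =>
      edges (partialSum fun i => X i ω) (vertexIndex j 0) m := fun m => by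
    simp only [edges_partialSum _ hmono]
    fun_prop
  have hS : ∀ m, IdentDistrib (S m (j m)) (walk X (j m)) P' P := fun m =>
    (hcopy m).comp (measurable_pi_apply (j m))
  have hE : ∀ m : Fin k, IdentDistrib
      (fun ω => edges (partialSum fun i => X i ω) (vertexIndex j 0) m) (walk X (j m)) P P := by
    intro m
    have h1 := (identDistrib_comp_injective mX h hident
      (σ := fun i => blockStart j m + i) (add_right_injective _)).comp
        (u := fun x : ℕ → EuclideanSpace ℝ (Fin (k + 1)) => ∑ i ∈ Finset.range (j m), x i)
        (by fun_prop)
    convert h1 using 1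
    · funext ω
      rw [edges_partialSum _ hmono, vertexIndex_succ, Finset.sum_Ico_eq_sum_range]
      simp [vertexIndex]
    · rfl
  have hident' : IdentDistrib (fun ω m => edges (partialSum fun i => X i ω) (vertexIndex j 0) m)
      (fun ω' m => S m (j m) ω') P P' := by
    refine ⟨(measurable_pi_iff.2 hmE).aemeasurable,
      aemeasurable_pi_iff.2 fun m => (hS m).aemeasurable_fst, ?_⟩
    rw [(iIndepFun_iff_map_fun_eq_pi_map fun m => (hmE m).aemeasurable).1
        (iIndepFun_edges mX h hmono),
      (iIndepFun_iff_map_fun_eq_pi_map fun m => (hS m).aemeasurable_fst).1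
        (hcopies.comp (fun m f => f (j m)) fun m => measurable_pi_apply (j m))]
    congr 1
    funext m
    exact (hE m).map_eq.trans (hS m).map_eq.symm
  exact (hident'.comp measurable_gramVolume).lintegral_eq

theorem expected_surface_area {Ω' : Type*} [MeasurableSpace Ω'] {P' : Measure Ω'}
    [IsProbabilityMeasure P'] (mX : ∀ i, Measurable (X i)) (h : iIndepFun X P)
    (hident : ∀ i, IdentDistrib (X i) (X 0) P P) (hX : ChargesNoHyperplane (X 0) P)
    {n : ℕ} (hn : k + 1 ≤ n)
    {S : Fin k → ℕ → Ω' → EuclideanSpace ℝ (Fin (k + 1))}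
    (hcopy : ∀ m, IdentDistrib (fun ω' p => S m p ω') (fun ω p => walk X p ω) P' P)
    (hcopies : iIndepFun (fun m ω' p => S m p ω') P') :
    AEMeasurable (fun ω => μHE[k] (frontier (walkHull X n ω))) P ∧
    ∫⁻ ω, μHE[k] (frontier (walkHull X n ω)) ∂P =
      2 / (k ! : ℝ≥0∞) * ∑ j ∈ stepTuples k n,
        (∫⁻ ω', gramVolume (fun m => S m (j m) ω') ∂P') / ∏ m, (j m : ℝ≥0∞) := by
  have hX' : ∀ i, ChargesNoHyperplane (X i) P := fun i => chargesNoHyperplane_congr (hident i) hX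
  have hmX : Measurable fun ω i => X i ω := measurable_pi_iff.2 mX
  have hmF : ∀ (s : ℝ) (j : Fin k → ℕ) (i : ℕ),
      Measurable fun ω => facetVolume s n j i (fun i => X i ω) := fun s j i =>
    (measurable_facetVolume _ _ _ _).comp hmX
  have hmterm : ∀ (j : Fin k → ℕ) (i : ℕ), Measurable fun ω =>
      (facetVolume 1 n j i (fun i => X i ω) + facetVolume (-1) n j i (fun i => X i ω)) /
        (k ! : ℝ≥0∞) := fun j i => ((hmF 1 j i).add (hmF (-1) j i)).div_const _
  -- The surface area is only known almost surely as this measurable sum, hence `AEMeasurable` in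
  -- the conclusion.
  have hae : (fun ω => μHE[k] (frontier (walkHull X n ω))) =ᵐ[P] fun ω =>
      ∑ j ∈ stepTuples k n, ∑ i ∈ Finset.range (n - ∑ m, j m + 1),
        (facetVolume 1 n j i (fun i => X i ω) + facetVolume (-1) n j i (fun i => X i ω)) /
          (k ! : ℝ≥0∞) := by
    filter_upwards [ae_inGeneralPosition mX h hX' n] with ω hω
    exact hω.measure_frontier_partialSum hn
  refine ⟨AEMeasurable.congr (Measurable.aemeasurable ?_) hae.symm, ?_⟩
  · exact Finset.measurable_fun_sum _ fun j _ => Finset.measurable_fun_sum _ fun i _ => hmterm j i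
  rw [lintegral_congr_ae hae, lintegral_finsetSum _ fun j _ =>
    Finset.measurable_fun_sum _ fun i _ => hmterm j i, Finset.mul_sum]
  refine Finset.sum_congr rfl fun j hj => ?_
  rw [lintegral_finsetSum _ fun i _ => hmterm j i]
  simp only [ENNReal.div_eq_inv_mul]
  have hk : ((k ! : ℝ≥0∞))⁻¹ ≠ ∞ := ENNReal.inv_ne_top.2 (by exact_mod_cast k.factorial_ne_zero)
  simp_rw [fun i => lintegral_const_mul' (μ := P) ((k ! : ℝ≥0∞))⁻¹ (fun ω =>
    facetVolume 1 n j i (fun i => X i ω) + facetVolume (-1) n j i (fun i => X i ω)) hk,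
    fun i => lintegral_add_left (μ := P) (hmF 1 j i)
      (fun ω => facetVolume (-1) n j i (fun i => X i ω))]
  rw [← Finset.mul_sum, Finset.sum_add_distrib,
    lintegral_sum_facetVolume mX h hident hX one_ne_zero hj,
    lintegral_sum_facetVolume mX h hident hX (neg_ne_zero.2 one_ne_zero) hj,
    lintegral_gramVolume_edges mX h hident hcopy hcopies j, ← two_mul, ENNReal.div_eq_inv_mul,
    mul_assoc]

end Expectation

/-! ### The final formula and the planar case. -/

theorem gramVolume_fin_one {V : Type*} [NormedAddCommGroup V] [InnerProductSpace ℝ V]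
    (e : Fin 1 → V) : gramVolume e = ENNReal.ofReal ‖e 0‖ := by
  rw [gramVolume, Matrix.det_fin_one, Matrix.gram_apply, real_inner_self_eq_norm_sq,
    Real.sqrt_sq (norm_nonneg _)]

theorem sum_stepTuples_one {M : Type*} [AddCommMonoid M] (n : ℕ) (g : ℕ → M) :
    ∑ j ∈ stepTuples 1 n, g (j 0) = ∑ j ∈ Finset.Icc 1 n, g j := by
  refine Finset.sum_bij (fun j _ => j 0) (fun j hj => ?_) (fun j _ j' _ h => ?_) (fun p hp => ?_)
    fun _ _ => rfl
  · rw [mem_stepTuples] at hj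
    simpa using ⟨hj.1 0, by simpa using hj.2⟩
  · funext m
    rw [Subsingleton.elim m 0]
    exact h
  · refine ⟨fun _ => p, ?_, rfl⟩
    simpa [mem_stepTuples] using hp

theorem corollary1
    {Ω : Type*} [MeasurableSpace Ω] (P : Measure Ω) [IsProbabilityMeasure P]
    {Ω' : Type*} [MeasurableSpace Ω'] (P' : Measure Ω') [IsProbabilityMeasure P']
    (d n : ℕ) (hd : 1 ≤ d) (hn : d ≤ n)
    -- i.i.d. increments whose law does not charge affine hyperplanes
    (X : ℕ → Ω → EuclideanSpace ℝ (Fin d))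
    (hmeas : ∀ i, Measurable (X i))
    (hindep : iIndepFun X P)
    (hident : ∀ i, IdentDistrib (X i) (X 0) P P)
    (hH : ChargesNoHyperplane (X 0) P)
    -- `S' 0, …, S' (d - 2)` are independent copies of the random walk
    (S' : Fin (d - 1) → ℕ → Ω' → EuclideanSpace ℝ (Fin d))
    (hcopy : ∀ m, IdentDistrib (fun ω' k => S' m k ω') (fun ω k => walk X k ω) P' P)
    (hcopies : iIndepFun (fun m ω' k => S' m k ω') P') :
    AEMeasurable (fun ω => μHE[d - 1] (frontier (walkHull X n ω))) P ∧
    ∫⁻ ω, μHE[d - 1] (frontier (walkHull X n ω)) ∂P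
      = 2 / ((d - 1)! : ℝ≥0∞) * ∑ j ∈ stepTuples (d - 1) n,
          (∫⁻ ω', ENNReal.ofReal
              (√(Matrix.gram ℝ fun m : Fin (d - 1) => S' m (j m) ω').det) ∂P')
            / ∏ m, (j m : ℝ≥0∞) ∧
    (d = 2 →
      ∫⁻ ω, μHE[1] (frontier (walkHull X n ω)) ∂P
        = 2 * ∑ j ∈ Finset.Icc 1 n, (∫⁻ ω, ENNReal.ofReal ‖walk X j ω‖ ∂P) / (j : ℝ≥0∞)) := by
  -- Writing `d = k + 1` makes `d - 1` reduce to `k`.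
  obtain ⟨k, rfl⟩ := Nat.exists_eq_add_of_le' hd
  obtain ⟨hmeas', hlint⟩ := expected_surface_area (k := k) hmeas hindep hident hH hn
    (S := S') hcopy hcopies
  refine ⟨hmeas', hlint, fun hk => ?_⟩
  obtain rfl : k = 1 := by omega
  rw [hlint, Nat.factorial_one, Nat.cast_one, div_one, ← sum_stepTuples_one]
  congr 1
  refine Finset.sum_congr rfl fun j _ => ?_
  simp only [gramVolume_fin_one, Fin.prod_univ_one]
  congr 1
  have hu : Measurable fun x : ℕ → EuclideanSpace ℝ (Fin (1 + 1)) => ENNReal.ofReal ‖x (j 0)‖ := by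
    fun_prop
  exact ((hcopy 0).comp hu).lintegral_eq
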